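/- Let $G$ be a finite abelian group (written additively). A finite indexed multiset $S=\{g_1,\dots,g_\ell\}$ ($\ell\ge 0$) of elements of $G$ is zero-sum if $\sum_i g_i=0$, and minimal zero-sum if moreover no nonempty proper indexed submultiset of it has sum $0$. An irreducible factorization of an indexed multiset $S$ over $G\setminus\{0\}$ is a partition of the index set $\{1,\dots,\ell\}$ into nonempty (unordered) blocks $I$ such that each $S(I)=\{g_i : i\in I\}$ is minimal zero-sum. A zero-sum indexed multiset $S$ over $G\setminus\{0\}$ with exactly one irreducible factorization is called a unique factorization indexed multiset (UFIM); the empty multiset is one. Put $$k(S)=\sum_{i=1}^{\ell}\frac1{\operatorname{ord}(g_i)},\qquad K_1(G)=\max\{k(S) : S\text{ is a UFIM over }G\setminus\{0\}\},$$ and, for $G\cong\bigoplus_{i\in I} C_{p_i^{e_i}}$ with $I$ finite, $p_i$ prime (not necessarily distinct) and $e_i\ge 1$, $$K_1^*(G)=\sum_{i\in I}\frac{p_i^{e_i}-1}{p_i^{e_i}-p_i^{e_i-1}} .$$ Let $P^-(n)$ and $P^+(n)$ denote the smallest and the largest prime divisor of $n$, and $\omega(n)$ the number of distinct prime divisors of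 $n$. For $c\in\mathbb R_{\ge1}$, $N\in\mathbb N$ and $(l_1,\dots,l_r)\in\mathbb N^r$, let - $\Omega_c$ be the class of finite abelian groups $G$ with $P^+(|G|)\le c\,P^-(|G|)$; - $\mathcal S_N$ be the class of finite abelian groups $G\cong\bigoplus_{i\in I} C_{p_i^{e_i}}$ (as above) with $\sum_{i\in I} e_i\le N$; - $\mathcal E_{(l_1,\dots,l_r)}$ be the class of finite abelian groups $G\cong\bigoplus_{i=1}^r C_{n_i}$ with $1<n_1\mid\cdots\mid n_r$ such that $\omega(n_i)=l_i$ and $\gcd(n_i,n_r/n_i)=1$ for all $1\le i\le r$. Corollary 8.6. For any fixed $c\in\mathbb R_{\ge 1}$, $N\in\mathbb N$, $r\in\mathbb N$ and $l_1,\dots,l_r\in\mathbb N$, $$\lim_{P^-(|G|)\to\infty,\ G\in\Omega_c\cap\mathcal S_N\cap\mathcal E_{(l_1,\dots,l_r)}}|K_1(G)-K_1^*(G)|=0,$$ that is, for every $\varepsilon>0$ there is an $M$, depending only on $\varepsilon,c,N,r,l_1,\dots,l_r$, such that $|K_1(G)-K_1^*(G)|<\varepsilon$ for every $G\in\Omega_c\cap\mathcal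 S_N\cap\mathcal E_{(l_1,\dots,l_r)}$ with $P^-(|G|)\ge M$. -/

import Mathlib

namespace CrossNumber

section IndexedMultisets

variable {G : Type*} [AddCommGroup G]

/-- A finite indexed multiset `S = {g_1, …, g_ℓ}` over `G` is a family `s : Fin ℓ → G`; the
submultiset `S(I)` is the restriction of `s` to the set of indices `I`.
`IsMinimalZeroSum s I` says that `S(I)` is minimal zero-sum: it has sum zero, and no nonempty
proper submultiset of it has sum zero. -/
def IsMinimalZeroSum {ℓ : ℕ} (s : Fin ℓ → G) (I : Finset (Fin ℓ)) : Prop :=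
  ∑ i ∈ I, s i = 0 ∧ ∀ J : Finset (Fin ℓ), J.Nonempty → J ⊂ I → ∑ i ∈ J, s i ≠ 0

/-- An irreducible factorization: a partition of the index set into (nonempty) blocks `I` with
`S(I)` minimal zero-sum. A `Finpartition` is an unordered set of blocks, so that equivalent
irreducible factorizations are equal here. -/
def IsIrreducibleFactorization {ℓ : ℕ} (s : Fin ℓ → G)
    (P : Finpartition (Finset.univ : Finset (Fin ℓ))) : Prop :=
  ∀ I ∈ P.parts, IsMinimalZeroSum s I

/-- A unique factorization indexed multiset over `G \ {0}`. -/
def IsUFIM {ℓ : ℕ} (s : Fin ℓ → G) : Prop :=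
  (∀ i, s i ≠ 0) ∧ ∑ i, s i = 0 ∧
    ∃! P : Finpartition (Finset.univ : Finset (Fin ℓ)), IsIrreducibleFactorization s P

/-- The cross number `k(S)` of an indexed multiset. -/
noncomputable def crossNumber {ℓ : ℕ} (s : Fin ℓ → G) : ℝ :=
  ∑ i, 1 / (addOrderOf (s i) : ℝ)

variable (G) in
/-- The set of cross numbers of all unique factorization indexed multisets over `G \ {0}`. -/
def ufimCrossNumbers : Set ℝ :=
  {x | ∃ (ℓ : ℕ) (s : Fin ℓ → G), IsUFIM s ∧ crossNumber s = x}

variable (G) in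
/-- `K₁(G)`, the maximal cross number of a unique factorization indexed multiset over `G \ {0}`;
that this supremum is a maximum is `isGreatest_K1` below. -/
noncomputable def K1 : ℝ := sSup (ufimCrossNumbers G)

theorem exists_factorization {ℓ : ℕ} (s : Fin ℓ → G) (I : Finset (Fin ℓ))
    (hI : ∑ i ∈ I, s i = 0) :
    ∃ P : Finpartition I, ∀ J ∈ P.parts, IsMinimalZeroSum s J := by
  induction I using Finset.strongInduction with
  | H I ih =>
    rcases I.eq_empty_or_nonempty with rfl | hne
    · exact ⟨⊥, by simp⟩
    · obtain ⟨J, hJ⟩ := Set.Finite.exists_minimal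
        (s := {J : Finset (Fin ℓ) | J.Nonempty ∧ J ⊆ I ∧ ∑ i ∈ J, s i = 0})
        (Set.toFinite _) ⟨I, hne, subset_rfl, hI⟩
      obtain ⟨⟨hJne, hJI, hJ0⟩, hmin⟩ := hJ
      have hsd : ∑ i ∈ I \ J, s i = 0 := by
        have := Finset.sum_sdiff (f := s) hJI
        rw [hJ0, hI, add_zero] at this
        exact this
      obtain ⟨P, hP⟩ := ih (I \ J) (Finset.sdiff_ssubset hJI hJne) hsd
      refine ⟨P.extend (b := J) (by simpa using hJne.ne_empty) Finset.sdiff_disjoint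
        (by simpa using hJI), ?_⟩
      intro K hK
      simp only [Finpartition.extend, Finset.mem_insert] at hK
      rcases hK with rfl | hK
      · refine ⟨hJ0, fun L hL hLK h0 => ?_⟩
        exact hLK.2 (hmin ⟨hL, hLK.1.trans hJI, h0⟩ hLK.1)
      · exact hP K hK

/-- Every minimal zero-sum submultiset of a zero-sum multiset is a block of some factorization. -/
theorem exists_factorization_mem {ℓ : ℕ} (s : Fin ℓ → G) (h0 : ∑ i, s i = 0)
    (J : Finset (Fin ℓ)) (hne : J.Nonempty) (hJ : IsMinimalZeroSum s J) :
    ∃ P : Finpartition (Finset.univ : Finset (Fin ℓ)),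
      IsIrreducibleFactorization s P ∧ J ∈ P.parts := by
  have hsd : ∑ i ∈ Finset.univ \ J, s i = 0 := by
    have := Finset.sum_sdiff (f := s) (Finset.subset_univ J)
    rw [hJ.1, h0, add_zero] at this
    exact this
  obtain ⟨P, hP⟩ := exists_factorization s _ hsd
  refine ⟨P.extend (b := J) (by simpa using hne.ne_empty) Finset.sdiff_disjoint
    (by simp), ?_, by simp [Finpartition.extend]⟩
  intro K hK
  simp only [Finpartition.extend, Finset.mem_insert] at hK
  rcases hK with rfl | hK
  · exact hJ
  · exact hP K hK

/-- In a unique factorization indexed multiset an element occurs at most as often as its order. -/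
theorem IsUFIM.card_fiber_le [Finite G] [DecidableEq G] {ℓ : ℕ} {s : Fin ℓ → G} (hs : IsUFIM s)
    (g : G) : (Finset.univ.filter fun i => s i = g).card ≤ addOrderOf g := by
  by_contra! hlt
  set A := Finset.univ.filter fun i => s i = g with hA
  have hd : 0 < addOrderOf g := addOrderOf_pos g
  have key : ∀ J ⊆ A, J.card = addOrderOf g → IsMinimalZeroSum s J := by
    intro J hJA hJ
    have hsum : ∀ K ⊆ A, ∑ i ∈ K, s i = K.card • g := by
      intro K hK
      rw [Finset.sum_congr rfl (fun i hi => (Finset.mem_filter.mp (hK hi)).2)]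
      simp
    refine ⟨by rw [hsum J hJA, hJ, addOrderOf_nsmul_eq_zero], fun K hK hKJ h => ?_⟩
    rw [hsum K (hKJ.1.trans hJA)] at h
    have h1 := Nat.le_of_dvd hK.card_pos (addOrderOf_dvd_of_nsmul_eq_zero h)
    have h2 := Finset.card_lt_card hKJ
    omega
  obtain ⟨B, hBA, hB⟩ := Finset.exists_subset_card_eq (Nat.succ_le_of_lt hlt)
  -- remove two different elements of `B` if there are two
  have hBne : B.Nonempty := Finset.card_pos.mp (by omega)
  obtain ⟨x, hx, y, hy, hxy⟩ := Finset.one_lt_card.mp (show 1 < B.card by omega)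
  have hcx : (B.erase x).card = addOrderOf g := by rw [Finset.card_erase_of_mem hx]; omega
  have hcy : (B.erase y).card = addOrderOf g := by rw [Finset.card_erase_of_mem hy]; omega
  obtain ⟨P, hP, hPm⟩ := exists_factorization_mem s hs.2.1 (B.erase x)
    (Finset.card_pos.mp (by omega)) (key _ ((Finset.erase_subset _ _).trans hBA) hcx)
  obtain ⟨Q, hQ, hQm⟩ := exists_factorization_mem s hs.2.1 (B.erase y)
    (Finset.card_pos.mp (by omega)) (key _ ((Finset.erase_subset _ _).trans hBA) hcy)
  have hPQ : P = Q := hs.2.2.unique hP hQ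
  subst hPQ
  have hg : g ≠ 0 := by
    have := (Finset.mem_filter.mp (hBA hx)).2
    rw [← this]
    exact hs.1 x
  have hd1 : addOrderOf g ≠ 1 := by simpa using hg
  -- a third element lies in both blocks
  have h3 : ((B.erase x).erase y).Nonempty := by
    apply Finset.card_pos.mp
    rw [Finset.card_erase_of_mem (Finset.mem_erase.mpr ⟨hxy.symm, hy⟩)]
    omega
  obtain ⟨z, hz⟩ := h3
  simp only [Finset.mem_erase] at hz
  have heq : B.erase x = B.erase y :=
    P.disjoint.elim_finset hPm hQm z (by simp [hz]) (by simp [hz])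
  have : y ∈ B.erase y := heq ▸ Finset.mem_erase.mpr ⟨hxy.symm, hy⟩
  simp at this

theorem IsUFIM.length_le [Finite G] {ℓ : ℕ} {s : Fin ℓ → G} (hs : IsUFIM s) :
    ℓ ≤ Nat.card G * Nat.card G := by
  classical
  cases nonempty_fintype G
  have h := Finset.card_eq_sum_card_fiberwise (f := s) (s := Finset.univ) (t := Finset.univ)
    (fun _ _ => by simp)
  rw [Finset.card_univ, Fintype.card_fin] at h
  rw [h]
  refine (Finset.sum_le_sum fun g _ => (hs.card_fiber_le g).trans (addOrderOf_le_card)).trans ?_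
  simp

theorem isUFIM_empty : IsUFIM (Fin.elim0 : Fin 0 → G) := by
  refine ⟨fun i => i.elim0, by simp, ⊥, ?_, ?_⟩
  · intro I hI
    simp at hI
  · intro P _
    ext I
    constructor
    · intro hI
      exact absurd (Finset.eq_empty_of_isEmpty I) (P.ne_bot hI)
    · intro hI
      simp at hI

variable (G) in
/-- The supremum that defines `K1` is attained. -/
theorem isGreatest_K1 [Finite G] : IsGreatest (ufimCrossNumbers G) (K1 G) := by
  have hfin : (ufimCrossNumbers G).Finite := by
    refine Set.Finite.subset (Set.Finite.biUnion (Set.finite_Iic (Nat.card G * Nat.card G))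
      (t := fun ℓ => Set.range fun s : Fin ℓ → G => crossNumber s)
      fun ℓ _ => Set.finite_range _) ?_
    rintro x ⟨ℓ, s, hs, rfl⟩
    simp only [Set.mem_iUnion]
    exact ⟨ℓ, hs.length_le, s, rfl⟩
  have hne : (ufimCrossNumbers G).Nonempty := ⟨_, 0, Fin.elim0, isUFIM_empty, rfl⟩
  exact ⟨hne.csSup_mem hfin, fun x hx => le_csSup hfin.bddAbove hx⟩

end IndexedMultisets

section Decompositions

/-- A decomposition of `G` into a (finite) direct sum of nontrivial cyclic groups of prime power
order; the direct sum of finitely many groups is their product. -/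
structure PrimePowerDecomposition (G : Type*) [AddCommGroup G] where
  ι : Type
  [fintype : Fintype ι]
  p : ι → ℕ
  e : ι → ℕ
  prime : ∀ i, (p i).Prime
  pos : ∀ i, 1 ≤ e i
  equiv : G ≃+ ((i : ι) → ZMod (p i ^ e i))

attribute [instance] PrimePowerDecomposition.fintype

variable {G : Type*} [AddCommGroup G]

/-- The sum `∑ (p^e - 1) / (p^e - p^(e-1))` over the cyclic summands of a decomposition. -/
noncomputable def PrimePowerDecomposition.K1star (D : PrimePowerDecomposition G) : ℝ :=
  ∑ i, ((D.p i : ℝ) ^ D.e i - 1) / ((D.p i : ℝ) ^ D.e i - (D.p i : ℝ) ^ (D.e i - 1))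

theorem nonempty_primePowerDecomposition (G : Type*) [AddCommGroup G] [Finite G] :
    Nonempty (PrimePowerDecomposition G) := by
  obtain ⟨ι, _, p, hp, e, ⟨f⟩⟩ := AddCommGroup.equiv_directSum_zmod_of_finite G
  classical
  let A : (DirectSum ι fun i => ZMod (p i ^ e i)) ≃+ ((i : ι) → ZMod (p i ^ e i)) :=
    (DirectSum.linearEquivFunOnFintype ℤ ι fun i => ZMod (p i ^ e i)).toAddEquiv
  let ρ : ((i : ι) → ZMod (p i ^ e i)) →+
      ((i : {i : ι // 1 ≤ e i}) → ZMod (p i ^ e i)) :=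
    { toFun := fun x i => x i, map_zero' := rfl, map_add' := fun _ _ => rfl }
  have hρ : Function.Bijective ρ := by
    constructor
    · intro x y h
      funext i
      by_cases hi : 1 ≤ e i
      · exact congrFun h ⟨i, hi⟩
      · have h0 : p i ^ e i = 1 := by
          have : e i = 0 := by omega
          rw [this, pow_zero]
        have : Subsingleton (ZMod (p i ^ e i)) := by rw [h0]; infer_instance
        exact Subsingleton.elim _ _
    · intro y
      refine ⟨fun i => if hi : 1 ≤ e i then y ⟨i, hi⟩ else 0, ?_⟩
      funext i
      simp [ρ, i.2]
  exact ⟨{ ι := {i : ι // 1 ≤ e i}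
           p := fun i => p i
           e := fun i => e i
           prime := fun i => hp i
           pos := fun i => i.2
           equiv := (f.trans A).trans (AddEquiv.ofBijective ρ hρ) }⟩

/-- `K₁*(G)`, computed from a decomposition of `G` into cyclic groups of prime power order; it does
not depend on the decomposition, see `K1star_eq` below. -/
noncomputable def K1star (G : Type*) [AddCommGroup G] [Finite G] : ℝ :=
  (nonempty_primePowerDecomposition G).some.K1star

theorem PrimePowerDecomposition.card_torsion (D : PrimePowerDecomposition G) (q k : ℕ)
    (hq : q.Prime) :
    Nat.card {g : G // q ^ k • g = 0} = q ^ ∑ i, if D.p i = q then min k (D.e i) else 0 := by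
  have hcyc : ∀ i, Nat.card {x : ZMod (D.p i ^ D.e i) // q ^ k • x = 0} =
      q ^ (if D.p i = q then min k (D.e i) else 0) := by
    intro i
    have : NeZero (D.p i ^ D.e i) := ⟨pow_ne_zero _ (D.prime i).ne_zero⟩
    have h := IsAddCyclic.card_nsmulAddMonoidHom_ker (G := ZMod (D.p i ^ D.e i)) (q ^ k)
    have h' : Nat.card {x : ZMod (D.p i ^ D.e i) // q ^ k • x = 0} =
        (D.p i ^ D.e i).gcd (q ^ k) := by
      rw [Nat.card_zmod] at h
      exact h
    rw [h']
    split_ifs with hpq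
    · rw [hpq]
      rcases le_total k (D.e i) with hk | hk
      · rw [min_eq_left hk, Nat.gcd_eq_right (pow_dvd_pow q hk)]
      · rw [min_eq_right hk, Nat.gcd_eq_left (pow_dvd_pow q hk)]
    · rw [pow_zero]
      exact Nat.Coprime.pow _ _ ((Nat.coprime_primes (D.prime i) hq).mpr hpq)
  rw [← Finset.prod_pow_eq_pow_sum, ← Finset.prod_congr rfl fun i _ => hcyc i, ← Nat.card_pi]
  refine Nat.card_congr
    { toFun := fun g i => ⟨D.equiv g.1 i, ?_⟩
      invFun := fun x => ⟨D.equiv.symm fun i => (x i).1, ?_⟩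
      left_inv := fun g => by simp
      right_inv := fun x => by simp }
  · have := congrFun (congrArg D.equiv g.2) i
    simpa using this
  · rw [← map_nsmul, AddEquiv.map_eq_zero_iff]
    funext i
    exact (x i).2

theorem PrimePowerDecomposition.K1star_eq_sum (D : PrimePowerDecomposition G) (s : Finset ℕ)
    (hs : ∀ i, D.p i ∈ s) (B : ℕ) (hB : ∀ i, D.e i ≤ B) :
    D.K1star = ∑ q ∈ s, ∑ k ∈ Finset.range B, (1 / (q : ℝ) ^ k) *
      (((∑ i, if D.p i = q then min (k + 1) (D.e i) else 0 : ℕ) : ℝ) -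
        ((∑ i, if D.p i = q then min k (D.e i) else 0 : ℕ) : ℝ)) := by
  have h1 : ∀ i, ((D.p i : ℝ) ^ D.e i - 1) / ((D.p i : ℝ) ^ D.e i - (D.p i : ℝ) ^ (D.e i - 1)) =
      ∑ k ∈ Finset.range B, (1 / (D.p i : ℝ) ^ k) *
        ((min (k + 1) (D.e i) : ℕ) - (min k (D.e i) : ℕ) : ℝ) := by
    intro i
    have hp1 : (1 : ℝ) < D.p i := by exact_mod_cast (D.prime i).one_lt
    have hp0 : (D.p i : ℝ) ≠ 0 := by positivity
    have h2 : ∑ k ∈ Finset.range B, (1 / (D.p i : ℝ) ^ k) *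
        ((min (k + 1) (D.e i) : ℕ) - (min k (D.e i) : ℕ) : ℝ) =
        ∑ k ∈ Finset.range (D.e i), (1 / (D.p i : ℝ)) ^ k := by
      rw [← Finset.sum_subset (Finset.range_mono (hB i))]
      · refine Finset.sum_congr rfl fun k hk => ?_
        have hk := Finset.mem_range.mp hk
        rw [min_eq_left hk.le, min_eq_left (by omega)]
        simp
      · intro k _ hk
        simp only [Finset.mem_range, not_lt] at hk
        rw [min_eq_right hk, min_eq_right (by omega)]
        simp
    rw [h2, geom_sum_eq (by rw [ne_eq, div_eq_one_iff_eq hp0]; exact hp1.ne)]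
    obtain ⟨m, hm⟩ : ∃ m, D.e i = m + 1 := ⟨D.e i - 1, by have := D.pos i; omega⟩
    rw [hm, Nat.add_sub_cancel]
    have h3 : (D.p i : ℝ) - 1 ≠ 0 := by linarith
    have h4 : (1 : ℝ) - D.p i ≠ 0 := by linarith
    have h5 : (D.p i : ℝ) ^ (m + 1) - (D.p i : ℝ) ^ m ≠ 0 := by
      rw [pow_succ, ← mul_sub_one]
      positivity
    have h6 : (1 / (D.p i : ℝ) - 1) ≠ 0 := by
      rw [div_sub_one hp0]
      positivity
    rw [div_eq_div_iff h5 h6, one_div, inv_pow]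
    field_simp
    ring
  rw [PrimePowerDecomposition.K1star, Finset.sum_congr rfl fun i _ => h1 i, Finset.sum_comm]
  conv_rhs => rw [Finset.sum_comm]
  refine Finset.sum_congr rfl fun k _ => ?_
  have h7 : ∀ q ∈ s, (1 / (q : ℝ) ^ k) *
      (((∑ i, if D.p i = q then min (k + 1) (D.e i) else 0 : ℕ) : ℝ) -
        ((∑ i, if D.p i = q then min k (D.e i) else 0 : ℕ) : ℝ)) =
      ∑ i, if D.p i = q then (1 / (D.p i : ℝ) ^ k) *
        ((min (k + 1) (D.e i) : ℕ) - (min k (D.e i) : ℕ) : ℝ) else 0 := by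
    intro q _
    rw [Nat.cast_sum, Nat.cast_sum, ← Finset.sum_sub_distrib, Finset.mul_sum]
    refine Finset.sum_congr rfl fun i _ => ?_
    split_ifs with h
    · rw [h]
    · simp
  rw [Finset.sum_congr rfl h7, Finset.sum_comm]
  refine Finset.sum_congr rfl fun i _ => ?_
  rw [Finset.sum_ite_eq, if_pos (hs i)]

theorem PrimePowerDecomposition.K1star_eq_K1star (D E : PrimePowerDecomposition G) :
    D.K1star = E.K1star := by
  classical
  let s : Finset ℕ := (Finset.univ.image D.p ∪ Finset.univ.image E.p).filter Nat.Prime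
  let B : ℕ := ∑ i, D.e i + ∑ i, E.e i
  have hD : ∀ i, D.e i ≤ B := fun i =>
    (Finset.single_le_sum (fun _ _ => Nat.zero_le _) (Finset.mem_univ i)).trans
      (Nat.le_add_right _ _)
  have hE : ∀ i, E.e i ≤ B := fun i =>
    (Finset.single_le_sum (fun _ _ => Nat.zero_le _) (Finset.mem_univ i)).trans
      (Nat.le_add_left _ _)
  rw [D.K1star_eq_sum s (fun i => by simp [s, D.prime i]) B hD,
    E.K1star_eq_sum s (fun i => by simp [s, E.prime i]) B hE]
  refine Finset.sum_congr rfl fun q hq => Finset.sum_congr rfl fun k _ => ?_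
  have hqp : q.Prime := (Finset.mem_filter.mp hq).2
  have h : ∀ k, (∑ i, if D.p i = q then min k (D.e i) else 0) =
      ∑ i, if E.p i = q then min k (E.e i) else 0 := fun k =>
    Nat.pow_right_injective hqp.two_le
      ((D.card_torsion q k hqp).symm.trans (E.card_torsion q k hqp))
  rw [h k, h (k + 1)]

/-- Every decomposition computes `K₁*(G)`. -/
theorem K1star_eq [Finite G] (D : PrimePowerDecomposition G) : K1star G = D.K1star :=
  PrimePowerDecomposition.K1star_eq_K1star _ _

end Decompositions

section Families

/-- The smallest prime divisor `P⁻(n)` of `n` (for `n ≥ 2`; the value at `1` is `1`). -/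
def smallestPrime (n : ℕ) : ℕ := n.minFac

/-- The largest prime divisor `P⁺(n)` of `n` (for `n ≥ 2`; the value at `1` is `0`). -/
def largestPrime (n : ℕ) : ℕ := n.primeFactors.sup id

/-- Membership in `Ω_c`: the largest prime divisor of `|G|` is at most `c` times the smallest. -/
def InOmega (c : ℝ) (G : Type*) : Prop :=
  (largestPrime (Nat.card G) : ℝ) ≤ c * (smallestPrime (Nat.card G) : ℝ)

/-- Membership in `𝒮_N`: the exponents in the decomposition of `G` into cyclic groups of prime power
order add up to at most `N`. -/
def InS (N : ℕ) (G : Type*) [AddCommGroup G] : Prop :=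
  ∃ D : PrimePowerDecomposition G, ∑ i, D.e i ≤ N

/-- Membership in `ℰ_{(l_1, …, l_r)}`: `G` is the direct sum of cyclic groups of orders
`1 < n_1 ∣ ⋯ ∣ n_r`, where `n_i` has exactly `l_i` distinct prime divisors and `n_i` is coprime
to `n_r / n_i`. The index `j` below is the last one. -/
def InE {r : ℕ} (l : Fin r → ℕ) (G : Type*) [AddCommGroup G] : Prop :=
  ∃ n : Fin r → ℕ, (∀ i, 1 < n i) ∧ (∀ i j, i ≤ j → n i ∣ n j) ∧
    (∀ i, (n i).primeFactors.card = l i) ∧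
    (∀ i j : Fin r, (j : ℕ) + 1 = r → Nat.gcd (n i) (n j / n i) = 1) ∧
    Nonempty (G ≃+ ((i : Fin r) → ZMod (n i)))

end Families

end CrossNumber

namespace CrossNumber

open Finset

/-! Let n be the number of cyclic summands of prime power order of G and P the smallest prime
divisor of |G|. Both invariants are within o(1) of n. For `K1star` this is elementary: each of the n
≤ N summands contributes between 1 and 1 + 1/(P - 1). For `K1` the lower bound n comes from
independent elements of prime order, each repeated as often as its order (`card_le_K1`).

For the upper bound, delete one element from each block of a UFIM. What remains is zero-sum free
(`isZeroSumFree_sdiff`). There are at most log₂|G| blocks (`two_pow_card_parts_le`) and each deleted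
element costs at most 1/P. Since |G| ≤ (cP)^N, this loss is O(N log P / P).

A zero-sum free family has cross number at most n + τ(|G|)δ, with τ the number of divisors
(`sum_inv_addOrderOf_le`). Elements of prime order p number at most r_p(p - 1) by Olson's bound, so
they contribute at most n altogether. Let d be composite with least prime p, d = pm. As long as at
least δp² elements have order d, some p of them have a sum killed by m; replacing them by this sum
keeps the family zero-sum free and does not lower the cross number. Otherwise order d contributes at
most δp²/d ≤ δ. As τ(|G|) ≤ 2^N, a small δ suffices.

The merging step needs p elements of sum zero among δp² elements of an elementary p-group of bounded
rank (`eventually_exists_zero_sum_card_eq_prime`). Either many elements lie in one coset of a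
character kernel, and the rank drops, or the elements are spread out, and a Fourier argument makes
the sets of subset sums grow until two of them each exceed half the group. -/

/-! ### Geometric sums at roots of unity -/

-- Parseval on the p-th roots of unity: expanding the square leaves only the diagonal j = j', by
-- orthogonality.
open ComplexConjugate in
theorem sum_sq_norm_geom_sum {p : ℕ} (hp : 0 < p) {ζ : ℂ} (hζ : IsPrimitiveRoot ζ p) {J : ℕ}
    (hJ : J ≤ p) : ∑ k ∈ range p, ‖∑ j ∈ range J, (ζ ^ k) ^ j‖ ^ 2 = p * J := by
  have hζ0 : ζ ≠ 0 := hζ.ne_zero hp.ne'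
  have hconj : conj ζ = ζ⁻¹ := (Complex.inv_eq_conj (hζ.norm'_eq_one hp.ne')).symm
  have hsum : ∀ j ∈ range J, ∀ j' ∈ range J,
      ∑ k ∈ range p, (ζ ^ j * ζ⁻¹ ^ j') ^ k = if j = j' then (p : ℂ) else 0 := by
    intro j hj j' hj'
    simp only [mem_range] at hj hj'
    split_ifs with h
    · subst h
      rw [← mul_pow, mul_inv_cancel₀ hζ0]
      simp
    · have h1 : ζ ^ j * ζ⁻¹ ^ j' ≠ 1 := by
        intro h1
        rw [inv_pow, mul_inv_eq_one₀ (pow_ne_zero _ hζ0)] at h1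
        exact h (hζ.pow_inj (by omega) (by omega) h1)
      have h2 : (ζ ^ j * ζ⁻¹ ^ j') ^ p = 1 := by
        rw [mul_pow, ← pow_mul, ← pow_mul, mul_comm j, mul_comm j', pow_mul, pow_mul, inv_pow,
          hζ.pow_eq_one]
        simp
      have h3 := geom_sum_mul (ζ ^ j * ζ⁻¹ ^ j') p
      rw [h2, sub_self] at h3
      exact (mul_eq_zero.mp h3).resolve_right (sub_ne_zero.mpr h1)
  have key : (∑ k ∈ range p, (‖∑ j ∈ range J, (ζ ^ k) ^ j‖ : ℂ) ^ 2) = p * J := by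
    calc (∑ k ∈ range p, (‖∑ j ∈ range J, (ζ ^ k) ^ j‖ : ℂ) ^ 2)
        = ∑ k ∈ range p, ∑ j ∈ range J, ∑ j' ∈ range J, (ζ ^ j * ζ⁻¹ ^ j') ^ k := by
          refine sum_congr rfl fun k _ => ?_
          rw [← Complex.mul_conj', map_sum, sum_mul_sum]
          refine sum_congr rfl fun j _ => sum_congr rfl fun j' _ => ?_
          rw [map_pow, map_pow, hconj, mul_pow, ← pow_mul, ← pow_mul, ← pow_mul, ← pow_mul,
            mul_comm j, mul_comm j']
      _ = ∑ j ∈ range J, ∑ j' ∈ range J, ∑ k ∈ range p, (ζ ^ j * ζ⁻¹ ^ j') ^ k := by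
          rw [sum_comm]
          exact sum_congr rfl fun j _ => sum_comm
      _ = ∑ j ∈ range J, ∑ j' ∈ range J, if j = j' then (p : ℂ) else 0 :=
          sum_congr rfl fun j hj => sum_congr rfl fun j' hj' => hsum j hj j' hj'
      _ = p * J := by
          simp only [sum_ite_eq]
          rw [sum_congr rfl fun j hj => if_pos hj]
          simp [mul_comm]
  exact_mod_cast key

/-- Cauchy–Schwarz reduces the bound to a sum of squares. Each root of unity is hit at most m times,
so that sum is at most m times the Parseval sum. -/
theorem sq_sum_norm_geom_sum_le {κ : Type*} (R : Finset κ) (z : κ → ℂ) {p J m : ℕ} (hp : 0 < p)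
    (hz : ∀ i ∈ R, z i ^ p = 1) (hm : ∀ w, #{i ∈ R | z i = w} ≤ m) (hJ : J ≤ p) :
    (∑ i ∈ R, ‖∑ j ∈ range J, z i ^ j‖) ^ 2 ≤ #R * (m * (p * J)) := by
  have : NeZero p := ⟨hp.ne'⟩
  refine (sq_sum_le_card_mul_sum_sq).trans ?_
  gcongr
  have hζ := Complex.isPrimitiveRoot_exp p hp.ne'
  set ζ := Complex.exp (2 * Real.pi * Complex.I / p)
  rw [← sum_sq_norm_geom_sum hp hζ hJ, mul_sum]
  have hk : ∀ i, ∃ k, i ∈ R → k < p ∧ ζ ^ k = z i := fun i => by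
    by_cases hi : i ∈ R
    · obtain ⟨k, hk⟩ := hζ.eq_pow_of_pow_eq_one (hz i hi)
      exact ⟨k, fun _ => hk⟩
    · exact ⟨0, fun h => absurd h hi⟩
  choose k hk using hk
  rw [← sum_fiberwise_of_maps_to (g := k) (t := range p) fun i hi => mem_range.mpr (hk i hi).1]
  refine sum_le_sum fun x _ => ?_
  have hx : ∀ i ∈ R.filter fun i => k i = x, z i = ζ ^ x := by
    intro i hi
    obtain ⟨hi, hix⟩ := mem_filter.mp hi
    rw [← hix, (hk i hi).2]
  rw [sum_congr rfl fun i hi => by rw [hx i hi], sum_const, nsmul_eq_mul]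
  gcongr
  refine le_trans ?_ (hm (ζ ^ x))
  exact card_le_card fun i hi => mem_filter.mpr ⟨(mem_filter.mp hi).1, hx i hi⟩

/-! ### Expansion by Fourier analysis -/

section Expansion

variable {V : Type*} [AddCommGroup V] [DecidableEq V]

/-- If translation by u + v takes y out of Y, then either u already does, or y + u is a point of Y
that v takes out. -/
theorem card_filter_add_notMem_add_le (Y : Finset V) (u v : V) :
    #{y ∈ Y | y + (u + v) ∉ Y} ≤ #{y ∈ Y | y + u ∉ Y} + #{y ∈ Y | y + v ∉ Y} := by
  have h : Y.filter (fun y => y + (u + v) ∉ Y) ⊆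
      Y.filter (fun y => y + u ∉ Y) ∪ (Y.filter (fun y => y + v ∉ Y)).image (fun y => y - u) := by
    intro y hy
    simp only [mem_filter, mem_union, mem_image] at hy ⊢
    by_cases hu : y + u ∈ Y
    · exact Or.inr ⟨y + u, ⟨hu, by rw [add_assoc]; exact hy.2⟩, by simp⟩
    · exact Or.inl ⟨hy.1, hu⟩
  exact (card_le_card h).trans ((card_union_le _ _).trans
    (Nat.add_le_add_left card_image_le _))

theorem card_filter_add_nsmul_notMem_le (Y : Finset V) (v : V) (j : ℕ) :
    #{y ∈ Y | y + j • v ∉ Y} ≤ j * #{y ∈ Y | y + v ∉ Y} := by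
  induction j with
  | zero => simp
  | succ j ih =>
    rw [succ_nsmul, add_mul, one_mul]
    exact (card_filter_add_notMem_add_le Y _ _).trans (by gcongr)

variable [Fintype V]

open ComplexConjugate in
-- Expand the squared norm and sum over ψ: orthogonality of characters keeps only the pairs with y +
-- v = y'.
theorem card_mul_card_filter_add_mem (Y : Finset V) (v : V) :
    (Fintype.card V : ℂ) * #{y ∈ Y | y + v ∈ Y} =
      ∑ ψ : AddChar V ℂ, (‖∑ y ∈ Y, ψ y‖ : ℂ) ^ 2 * ψ v := by
  have h : ∀ ψ : AddChar V ℂ, (‖∑ y ∈ Y, ψ y‖ : ℂ) ^ 2 * ψ v =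
      ∑ y ∈ Y, ∑ y' ∈ Y, ψ (y - y' + v) := by
    intro ψ
    rw [← Complex.mul_conj', map_sum, sum_mul_sum, sum_mul]
    refine sum_congr rfl fun y _ => ?_
    rw [sum_mul]
    refine sum_congr rfl fun y' _ => ?_
    rw [AddChar.map_add_eq_mul, sub_eq_add_neg, AddChar.map_add_eq_mul, AddChar.map_neg_eq_conj]
  rw [sum_congr rfl fun ψ _ => h ψ, sum_comm, card_filter, Nat.cast_sum, mul_sum]
  refine sum_congr rfl fun y _ => ?_
  rw [sum_comm]
  simp only [AddChar.sum_apply_eq_ite]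
  have h' : ∀ y', (y - y' + v = 0) ↔ y + v = y' := fun y' => by
    rw [sub_add_eq_add_sub, sub_eq_zero]
  simp only [h', sum_ite_eq]
  split_ifs <;> simp

/-- Expansion: if the values of every nontrivial character on the family `d` are spread out, then
some `d i` moves a large part of `Y` out of `Y`. -/
theorem exists_card_le_mul_card_filter_add_notMem {p J m : ℕ} (hp : 0 < p)
    (hpV : ∀ v : V, p • v = 0) {κ : Type*} (R : Finset κ) (hR : R.Nonempty) (d : κ → V)
    (hm : ∀ ψ : AddChar V ℂ, ψ ≠ 0 → ∀ w, #{i ∈ R | ψ (d i) = w} ≤ m) (hJ0 : 0 < J) (hJ : J ≤ p)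
    (hmJ : 16 * m * p ≤ J * #R) (Y : Finset V) (hY : 2 * #Y ≤ Fintype.card V) :
    ∃ i ∈ R, #Y ≤ 4 * J * #{y ∈ Y | y + d i ∉ Y} := by
  by_contra! hcon
  have hV : (0 : ℝ) < Fintype.card V := by exact_mod_cast Fintype.card_pos
  have hR0 : (0 : ℝ) < #R := by exact_mod_cast hR.card_pos
  have hJ0' : (0 : ℝ) < J := by exact_mod_cast hJ0
  -- The squared sum is at most |R|·m·p·J, and 16mp ≤ J|R| turns this into (|R|J/4)².
  have hchar : ∀ ψ : AddChar V ℂ, ψ ≠ 0 →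
      ‖∑ i ∈ R, ∑ j ∈ range J, ψ (j • d i)‖ ≤ #R * J / 4 := by
    intro ψ hψ
    simp only [AddChar.map_nsmul_eq_pow]
    refine (norm_sum_le _ _).trans ((pow_le_pow_iff_left₀ (by positivity) (by positivity) two_ne_zero).mp ?_)
    refine (sq_sum_norm_geom_sum_le R (fun i => ψ (d i)) hp (fun i _ => ?_) (hm ψ hψ) hJ).trans ?_
    · rw [← AddChar.map_nsmul_eq_pow, hpV, AddChar.map_zero_eq_one]
    · have h : (16 * m * p : ℝ) ≤ J * #R := by exact_mod_cast hmJ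
      have := mul_le_mul_of_nonneg_left h (mul_nonneg hR0.le hJ0'.le)
      nlinarith
  have hparseval : ∑ ψ : AddChar V ℂ, ‖∑ y ∈ Y, ψ y‖ ^ 2 = Fintype.card V * #Y := by
    have h := card_mul_card_filter_add_mem Y 0
    simp only [add_zero, filter_mem_eq_inter, inter_self, AddChar.map_zero_eq_one, mul_one] at h
    exact_mod_cast h.symm
  -- Nontrivial characters contribute at most a quarter of |V||Y||R|J by Parseval. The trivial one,
  -- after that quarter is split off, adds ¾|Y|²|R|J, at most ⅜ of it since 2|Y| ≤ |V|.
  have hupper : (Fintype.card V : ℝ) * ∑ i ∈ R, ∑ j ∈ range J, (#{y ∈ Y | y + j • d i ∈ Y} : ℝ) ≤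
      Fintype.card V * (#Y * (#R * J) * (3 / 4)) := by
    have h1 : (((Fintype.card V : ℝ) *
        ∑ i ∈ R, ∑ j ∈ range J, (#{y ∈ Y | y + j • d i ∈ Y} : ℝ) : ℝ) : ℂ) =
        ∑ ψ : AddChar V ℂ, (‖∑ y ∈ Y, ψ y‖ : ℂ) ^ 2 * ∑ i ∈ R, ∑ j ∈ range J, ψ (j • d i) := by
      push_cast
      simp only [mul_sum, card_mul_card_filter_add_mem]
      rw [sum_comm (s := univ)]
      refine sum_congr rfl fun i _ => ?_
      rw [sum_comm (s := univ)]
    have h2 : ∀ ψ : AddChar V ℂ,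
        ‖(‖∑ y ∈ Y, ψ y‖ : ℂ) ^ 2 * ∑ i ∈ R, ∑ j ∈ range J, ψ (j • d i)‖ ≤
          ‖∑ y ∈ Y, ψ y‖ ^ 2 * (#R * J / 4) +
            if ψ = 0 then (#Y : ℝ) ^ 2 * (#R * J * (3 / 4)) else 0 := by
      intro ψ
      rw [norm_mul, norm_pow, Complex.norm_real, norm_norm]
      split_ifs with hψ
      · subst hψ
        simp
        apply le_of_eq
        ring
      · rw [add_zero]
        gcongr
        exact hchar ψ hψ
    have h3 := congrArg norm h1
    rw [Complex.norm_real, Real.norm_of_nonneg (by positivity)] at h3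
    rw [h3]
    refine (norm_sum_le _ _).trans ((sum_le_sum fun ψ _ => h2 ψ).trans ?_)
    rw [sum_add_distrib, ← sum_mul, hparseval, sum_ite_eq', if_pos (mem_univ _)]
    have h4 : (2 * #Y : ℝ) ≤ Fintype.card V := by exact_mod_cast hY
    have h5 : (0 : ℝ) ≤ #Y * (#R * J) := by positivity
    nlinarith [mul_le_mul_of_nonneg_right h4 h5, mul_nonneg hV.le h5]
  -- If each d i moves fewer than |Y|/(4J) points out of Y, then j • d i with j < J moves fewer than
  -- |Y|/4. This contradicts the average in `hupper`.
  have hlower : ∀ i ∈ R, ∀ j ∈ range J, (#Y : ℝ) * (3 / 4) < #{y ∈ Y | y + j • d i ∈ Y} := by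
    intro i hi j hj
    have h1 := hcon i hi
    have h2 := card_filter_add_nsmul_notMem_le Y (d i) j
    have h3 := card_filter_add_card_filter_not (s := Y) (fun y => y + j • d i ∈ Y)
    have h4 : j * #{y ∈ Y | y + d i ∉ Y} ≤ J * #{y ∈ Y | y + d i ∉ Y} :=
      Nat.mul_le_mul_right _ (mem_range.mp hj).le
    have h5 : 3 * #Y < 4 * #{y ∈ Y | y + j • d i ∈ Y} := by
      rw [mul_assoc] at h1
      omega
    have h6 : (3 * #Y : ℝ) < 4 * #{y ∈ Y | y + j • d i ∈ Y} := by exact_mod_cast h5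
    linarith
  have h1 : ∑ i ∈ R, ∑ j ∈ range J, (#Y : ℝ) * (3 / 4) <
      ∑ i ∈ R, ∑ j ∈ range J, (#{y ∈ Y | y + j • d i ∈ Y} : ℝ) :=
    sum_lt_sum_of_nonempty hR fun i hi =>
      sum_lt_sum_of_nonempty (nonempty_range_iff.mpr hJ0.ne') fun j hj => hlower i hi j hj
  have h2 := le_of_mul_le_mul_left hupper hV
  simp only [sum_const, card_range, nsmul_eq_mul] at h1
  nlinarith

end Expansion

/-! ### Growth of sets of subset sums -/

section Greedy

variable {V : Type*} [AddCommGroup V] [Fintype V] [DecidableEq V]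

/-- Each step takes two unused indices i, j and adds exactly one of a i, a j to every sum, so all
sums keep the same length. Translating by a i, the new set is Y together with the translate by a j -
a i of the points this difference moves out of Y. Expansion gives the growth factor 1 + 1/(4J). -/
theorem exists_many_subset_sums {p J m : ℕ} (hp : 0 < p) (hpV : ∀ v : V, p • v = 0)
    {ι : Type*} [DecidableEq ι] (s : Finset ι) (a : ι → V)
    (hm : ∀ ψ : AddChar V ℂ, ψ ≠ 0 → ∀ w, #{i ∈ s | ψ (a i) = w} ≤ m) (hJ0 : 0 < J) (hJ : J ≤ p)
    {n : ℕ} (hn : 2 * n < #s) (hmJ : 16 * m * p + J * (2 * n) ≤ J * #s) :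
    ∀ k ≤ n, ∃ U ⊆ s, #U ≤ 2 * k ∧ ∃ Y : Finset V, (∀ y ∈ Y, ∃ T ⊆ U, #T = k ∧ ∑ i ∈ T, a i = y) ∧
      (Fintype.card V < 2 * #Y ∨ (1 + 1 / (4 * J) : ℝ) ^ k ≤ #Y) := by
  intro k
  induction k with
  | zero =>
    intro _
    exact ⟨∅, by simp, by simp, {0}, fun y hy => ⟨∅, by simp_all⟩, Or.inr (by simp)⟩
  | succ k ih =>
    intro hk
    obtain ⟨U, hUs, hU, Y, hY, hYc⟩ := ih (by omega)
    set R := s \ U with hRdef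
    have hRs : R ⊆ s := sdiff_subset
    have hRc : #s ≤ #R + 2 * n := by
      have : #R + #U = #s := card_sdiff_add_card_eq_card hUs
      omega
    have hRne : R.Nonempty := card_pos.mp (by omega)
    have hext : ∀ i ∈ R, ∀ y ∈ Y, ∃ T ⊆ insert i U, #T = k + 1 ∧ ∑ j ∈ T, a j = y + a i := by
      intro i hi y hy
      obtain ⟨T, hTU, hTc, hTs⟩ := hY y hy
      have hiT : i ∉ T := fun h => (mem_sdiff.mp hi).2 (hTU h)
      exact ⟨insert i T, insert_subset_insert _ hTU, by rw [card_insert_of_notMem hiT, hTc],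
        by rw [sum_insert hiT, hTs, add_comm]⟩
    -- Beyond half the group nothing more has to grow; a translate only keeps the length of the sums
    -- in step.
    by_cases hbig : Fintype.card V < 2 * #Y
    · obtain ⟨i, hi⟩ := hRne
      refine ⟨insert i U, insert_subset (hRs hi) hUs, (card_insert_le _ _).trans (by omega),
        Y.image (fun y => y + a i), ?_, Or.inl ?_⟩
      · intro y hy
        obtain ⟨x, hx, rfl⟩ := mem_image.mp hy
        exact hext i hi x hx
      · rwa [card_image_of_injective _ (add_left_injective _)]
    · have hYc := hYc.resolve_left hbig
      have hJR : (0 : ℝ) < J := by exact_mod_cast hJ0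
      have hY0 : (0 : ℝ) < #Y := lt_of_lt_of_le (by positivity) hYc
      -- Passing to differences multiplies the fibre bound by |R|, but the index set has |R|²
      -- elements, so the hypothesis of the expansion lemma is preserved.
      have hfib : ∀ ψ : AddChar V ℂ, ψ ≠ 0 → ∀ w,
          #{x ∈ R ×ˢ R | ψ (a x.2 - a x.1) = w} ≤ #R * m := by
        intro ψ hψ w
        rw [card_filter, sum_product, ← smul_eq_mul, ← sum_const]
        refine sum_le_sum fun i _ => ?_
        rw [← card_filter]
        refine le_trans (card_le_card fun j hj => ?_) (hm ψ hψ (w * ψ (a i)))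
        obtain ⟨hj, hjw⟩ := mem_filter.mp hj
        refine mem_filter.mpr ⟨hRs hj, ?_⟩
        rw [← hjw, ← AddChar.map_add_eq_mul, sub_add_cancel]
      have hmR : 16 * m * p ≤ J * #R := by
        have := Nat.mul_le_mul_left J hRc
        rw [mul_add] at this
        omega
      obtain ⟨⟨i, j⟩, hij, hYij⟩ := exists_card_le_mul_card_filter_add_notMem hp hpV (R ×ˢ R)
        (hRne.product hRne) (fun x => a x.2 - a x.1) hfib hJ0 hJ
        (by rw [card_product]; nlinarith [Nat.mul_le_mul_right (#R) hmR]) Y (by omega)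
      obtain ⟨hi, hj⟩ := mem_product.mp hij
      simp only at hi hj hYij
      set Z := Y.filter fun y => y + (a j - a i) ∉ Y with hZ
      have hdisj : Disjoint (Y.image (fun y => y + a i)) (Z.image (fun y => y + a j)) := by
        rw [disjoint_left]
        intro x hx hx'
        obtain ⟨y, hy, rfl⟩ := mem_image.mp hx
        obtain ⟨z, hz, hzy⟩ := mem_image.mp hx'
        apply (mem_filter.mp hz).2
        rwa [← add_sub_assoc, hzy, add_sub_cancel_right]
      refine ⟨insert i (insert j U), insert_subset (hRs hi) (insert_subset (hRs hj) hUs), ?_,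
        Y.image (fun y => y + a i) ∪ Z.image (fun y => y + a j), ?_, Or.inr ?_⟩
      · have h1 := card_insert_le i (insert j U)
        have h2 := card_insert_le j U
        omega
      · intro x hx
        rcases mem_union.mp hx with hx | hx
        · obtain ⟨y, hy, rfl⟩ := mem_image.mp hx
          obtain ⟨T, hT, h⟩ := hext i hi y hy
          exact ⟨T, hT.trans (insert_subset_insert _ (subset_insert _ _)), h⟩
        · obtain ⟨y, hy, rfl⟩ := mem_image.mp hx
          obtain ⟨T, hT, h⟩ := hext j hj y (mem_filter.mp hy).1
          exact ⟨T, hT.trans (subset_insert _ _), h⟩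
      · rw [card_union_of_disjoint hdisj, card_image_of_injective _ (add_left_injective _),
          card_image_of_injective _ (add_left_injective _), pow_succ]
        have h : (#Y : ℝ) ≤ 4 * J * #Z := by exact_mod_cast hYij
        have h' : (#Y : ℝ) / (4 * J) ≤ #Z := by
          rw [div_le_iff₀ (by positivity)]
          linarith
        push_cast
        calc (1 + 1 / (4 * J) : ℝ) ^ k * (1 + 1 / (4 * J)) ≤ #Y * (1 + 1 / (4 * J)) := by gcongr
          _ = #Y + #Y / (4 * J) := by ring
          _ ≤ #Y + #Z := by gcongr

/-- Write p = 2k + 1. Two disjoint parts of the family each give more than |V|/2 sums of length k,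
and one further element g is kept. By pigeonhole, some y and z from the two sets satisfy y + z = -g.
-/
theorem exists_zero_sum_of_fibers_le {p J m : ℕ} (hp : p.Prime) (hp2 : p ≠ 2)
    (hpV : ∀ v : V, p • v = 0) {ι : Type*} [DecidableEq ι] (s : Finset ι) (a : ι → V)
    (hm : ∀ ψ : AddChar V ℂ, ψ ≠ 0 → ∀ w, #{i ∈ s | ψ (a i) = w} ≤ m) (hJ0 : 0 < J) (hJ : J ≤ p)
    (hn : 2 * p < #s) (hmJ : 16 * m * p + J * (2 * p) ≤ J * #s)
    (hV : (Fintype.card V : ℝ) < 2 * (1 + 1 / (4 * J) : ℝ) ^ ((p - 1) / 2)) :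
    ∃ T ⊆ s, #T = p ∧ ∑ i ∈ T, a i = 0 := by
  obtain ⟨k, hk⟩ := hp.odd_of_ne_two hp2
  have hk' : (p - 1) / 2 = k := by omega
  rw [hk'] at hV
  have hlarge : ∀ Y : Finset V, (Fintype.card V < 2 * #Y ∨ (1 + 1 / (4 * J) : ℝ) ^ k ≤ #Y) →
      Fintype.card V < 2 * #Y := by
    rintro Y (h | h)
    · exact h
    · have : (Fintype.card V : ℝ) < 2 * #Y := by linarith
      exact_mod_cast this
  have hJk : J * (2 * p) = J * (2 * k) + J * (2 * k) + J * 2 := by rw [hk]; ring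
  obtain ⟨U₁, hU₁s, hU₁, Y₁, hY₁, hY₁c⟩ := exists_many_subset_sums hp.pos hpV s a hm hJ0 hJ
    (n := k) (by omega) (by omega) k le_rfl
  have hc₁ := card_sdiff_add_card_eq_card hU₁s
  obtain ⟨U₂, hU₂s, hU₂, Y₂, hY₂, hY₂c⟩ := exists_many_subset_sums hp.pos hpV (s \ U₁) a
    (fun ψ hψ w => (card_le_card (filter_subset_filter _ sdiff_subset)).trans (hm ψ hψ w)) hJ0 hJ
    (n := k) (by omega) (by
      have : J * #s ≤ J * #(s \ U₁) + J * (2 * k) := by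
        rw [← mul_add]
        exact Nat.mul_le_mul_left _ (by omega)
      omega) k le_rfl
  have hc₂ := card_sdiff_add_card_eq_card hU₂s
  obtain ⟨g, hg⟩ : ((s \ U₁) \ U₂).Nonempty := card_pos.mp (by omega)
  simp only [mem_sdiff] at hg
  obtain ⟨y, hy⟩ : (Y₁ ∩ Y₂.image fun y => -a g - y).Nonempty := by
    rw [nonempty_iff_ne_empty]
    intro h
    have h1 := card_union_of_disjoint (disjoint_iff_inter_eq_empty.mpr h)
    rw [card_image_of_injective _ sub_right_injective] at h1
    have h2 := card_le_univ (Y₁ ∪ Y₂.image fun y => -a g - y)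
    have h3 := hlarge _ hY₁c
    have h4 := hlarge _ hY₂c
    omega
  obtain ⟨hy₁, hy₂⟩ := mem_inter.mp hy
  obtain ⟨z, hz, hzy⟩ := mem_image.mp hy₂
  obtain ⟨T₁, hT₁, hT₁c, hT₁s⟩ := hY₁ y hy₁
  obtain ⟨T₂, hT₂, hT₂c, hT₂s⟩ := hY₂ z hz
  have hdisj : Disjoint T₁ T₂ := by
    rw [disjoint_left]
    exact fun x h1 h2 => (mem_sdiff.mp (hU₂s (hT₂ h2))).2 (hT₁ h1)
  have hgT : g ∉ T₁ ∪ T₂ := by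
    rw [mem_union]
    rintro (h | h)
    · exact hg.1.2 (hT₁ h)
    · exact hg.2 (hT₂ h)
  refine ⟨insert g (T₁ ∪ T₂), insert_subset hg.1.1 (union_subset (hT₁.trans hU₁s)
    (hT₂.trans (hU₂s.trans sdiff_subset))), ?_, ?_⟩
  · rw [card_insert_of_notMem hgT, card_union_of_disjoint hdisj]
    omega
  · rw [sum_insert hgT, sum_union hdisj, hT₁s, hT₂s, ← hzy]
    abel

end Greedy

/-! ### Zero-sum subfamilies of length p, by induction on the rank -/

/-- The kernel of a character, as a subgroup. -/
def charKer {V : Type*} [AddCommGroup V] (ψ : AddChar V ℂ) : AddSubgroup V where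
  carrier := {v | ψ v = 1}
  zero_mem' := ψ.map_zero_eq_one
  add_mem' := fun {x y} hx hy => by
    rw [Set.mem_ofPred_eq] at *
    rw [AddChar.map_add_eq_mul, hx, hy, one_mul]
  neg_mem' := fun {x} hx => by
    rw [Set.mem_ofPred_eq] at *
    rw [AddChar.map_neg_eq_inv, hx, inv_one]

theorem mem_charKer {V : Type*} [AddCommGroup V] {ψ : AddChar V ℂ} {v : V} :
    v ∈ charKer ψ ↔ ψ v = 1 := Iff.rfl

theorem card_charKer_mul_le {V : Type*} [AddCommGroup V] [Finite V] {p : ℕ} (hp : p.Prime)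
    (hpV : ∀ v : V, p • v = 0) {ψ : AddChar V ℂ} (hψ : ψ ≠ 0) :
    Nat.card (charKer ψ) * p ≤ Nat.card V := by
  obtain ⟨v, hv⟩ : ∃ v, ψ v ≠ 1 := by
    by_contra! h
    exact hψ (by ext v; simpa using h v)
  have hfact : Fact p.Prime := ⟨hp⟩
  have hord : addOrderOf (v : V ⧸ charKer ψ) = p := by
    apply addOrderOf_eq_prime
    · rw [← QuotientAddGroup.mk_nsmul, hpV]
      rfl
    · rwa [ne_eq, QuotientAddGroup.eq_zero_iff]
  have hdvd : p ∣ Nat.card (V ⧸ charKer ψ) := hord ▸ addOrderOf_dvd_natCard _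
  rw [AddSubgroup.card_eq_card_quotient_mul_card_addSubgroup (charKer ψ), mul_comm]
  exact Nat.mul_le_mul_right _ (Nat.le_of_dvd Nat.card_pos hdvd)

/-- Dichotomy with threshold m = K^r·p. A fibre of a nontrivial character with at least m elements
is translated into the kernel, where induction applies; the translation cancels on p elements since
p kills V. If all fibres are smaller, `exists_zero_sum_of_fibers_le` applies. -/
theorem exists_zero_sum_card_eq_prime {p J K R : ℕ} (hp : p.Prime) (hp2 : p ≠ 2) (hJ0 : 0 < J)
    (hJ : J ≤ p) (hKJ : 32 * p ≤ K * J)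
    (hgrow : (p : ℝ) ^ R < 2 * (1 + 1 / (4 * J) : ℝ) ^ ((p - 1) / 2)) (r : ℕ) (hr : r ≤ R)
    {V : Type*} [AddCommGroup V] [Finite V] (hpV : ∀ v : V, p • v = 0)
    (hV : Nat.card V ≤ p ^ r) {ι : Type*} (s : Finset ι) (a : ι → V) (hs : K ^ r * p ≤ #s) :
    ∃ T ⊆ s, #T = p ∧ ∑ i ∈ T, a i = 0 := by
  induction r generalizing V s a with
  | zero =>
    rw [pow_zero] at hV
    have := Finite.card_le_one_iff_subsingleton.mp hV
    obtain ⟨T, hT, hTc⟩ := exists_subset_card_eq (n := p) (s := s) (by simpa using hs)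
    exact ⟨T, hT, hTc, Subsingleton.elim _ _⟩
  | succ r ih =>
    classical
    have hK : 0 < K := by
      rcases Nat.eq_zero_or_pos K with rfl | h
      · have := hp.pos
        omega
      · exact h
    have hm0 : p ≤ K ^ r * p := Nat.le_mul_of_pos_left _ (pow_pos hK r)
    by_cases hfib : ∃ ψ : AddChar V ℂ, ψ ≠ 0 ∧ ∃ w, K ^ r * p ≤ #{i ∈ s | ψ (a i) = w}
    · obtain ⟨ψ, hψ, w, hw⟩ := hfib
      obtain ⟨i₀, hi₀⟩ : (s.filter fun i => ψ (a i) = w).Nonempty :=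
        card_pos.mp (hp.pos.trans_le (hm0.trans hw))
      have hi₀w := (mem_filter.mp hi₀).2
      have hker : ∀ i, ψ (a i) = w → a i - a i₀ ∈ charKer ψ := by
        intro i hi
        rw [mem_charKer, sub_eq_add_neg, AddChar.map_add_eq_mul, hi, ← hi₀w,
          ← AddChar.map_add_eq_mul, add_neg_cancel, AddChar.map_zero_eq_one]
      have hcard : Nat.card (charKer ψ) ≤ p ^ r := by
        refine Nat.le_of_mul_le_mul_right (c := p) ?_ hp.pos
        rw [← pow_succ]
        exact (card_charKer_mul_le hp hpV hψ).trans hV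
      obtain ⟨T, hT, hTc, hTs⟩ := ih (by omega) (V := charKer ψ)
        (fun v => Subtype.ext (hpV v)) hcard (s.filter fun i => ψ (a i) = w)
        (fun i => if h : ψ (a i) = w then ⟨a i - a i₀, hker i h⟩ else 0) hw
      refine ⟨T, hT.trans (filter_subset _ _), hTc, ?_⟩
      have h1 : ∑ i ∈ T, (a i - a i₀) = 0 := by
        rw [← map_zero (charKer ψ).subtype, ← hTs, map_sum]
        refine sum_congr rfl fun i hi => ?_
        rw [dif_pos (mem_filter.mp (hT hi)).2]
        rfl
      rwa [sum_sub_distrib, sum_const, hTc, hpV, sub_zero] at h1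
    · push Not at hfib
      have := Fintype.ofFinite V
      rw [pow_succ] at hs
      have h1 : J * (K ^ r * p * K) ≤ J * #s :=
        Nat.mul_le_mul_left _ (by linarith [hs, mul_right_comm (K ^ r) K p])
      have h2 : K ^ r * p * (32 * p) ≤ K ^ r * p * (K * J) := Nat.mul_le_mul_left _ hKJ
      have h3 : J * p ≤ K ^ r * p * p := Nat.mul_le_mul_right _ (hJ.trans hm0)
      -- Here J·#s ≥ JKm ≥ 32mp, and 2Jp ≤ 2mp because J ≤ p ≤ m.
      have h4 : 16 * (K ^ r * p) * p + J * (2 * p) ≤ J * #s := by nlinarith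
      have hJp : 0 < K ^ r * p * p := by have := hp.pos; positivity
      refine exists_zero_sum_of_fibers_le hp hp2 hpV s a
        (fun ψ hψ w => (hfib ψ hψ w).le) hJ0 hJ ?_ h4 ?_
      · by_contra! hle
        have := Nat.mul_le_mul_left J hle
        nlinarith
      · refine lt_of_le_of_lt ?_ hgrow
        rw [← Nat.card_eq_fintype_card]
        calc (Nat.card V : ℝ) ≤ (p : ℝ) ^ (r + 1) := by exact_mod_cast hV
          _ ≤ (p : ℝ) ^ R := pow_le_pow_right₀ (by exact_mod_cast hp.one_lt.le) hr

theorem eventually_mul_log_pow_le (C : ℝ) (n : ℕ) {δ : ℝ} (hδ : 0 < δ) :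
    ∀ᶠ k : ℕ in Filter.atTop, C * Real.log k ^ n ≤ δ * k := by
  have h := (Real.isLittleO_pow_log_id_atTop (n := n)).const_mul_left C
  filter_upwards [tendsto_natCast_atTop_atTop.eventually (h.bound hδ)] with k hk
  rw [id_eq, Real.norm_of_nonneg (Nat.cast_nonneg k)] at hk
  exact (le_abs_self _).trans hk

/-- A weak form of a theorem of Alon and Dubiner: in an elementary `p`-group of bounded rank,
`δ p²` elements contain `p` elements of sum zero once `p` is large. -/
theorem eventually_exists_zero_sum_card_eq_prime (r : ℕ) {δ : ℝ} (hδ : 0 < δ) :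
    ∃ p₀ : ℕ, ∀ p, p₀ ≤ p → p.Prime → ∀ (V : Type*) [AddCommGroup V] [Finite V],
      (∀ v : V, p • v = 0) → Nat.card V ≤ p ^ r → ∀ {ι : Type*} (s : Finset ι) (a : ι → V),
        δ * (p : ℝ) ^ 2 ≤ #s → ∃ T ⊆ s, #T = p ∧ ∑ i ∈ T, a i = 0 := by
  obtain ⟨p₀, hp₀⟩ := Filter.eventually_atTop.mp
    ((eventually_mul_log_pow_le (48 * (r + 1)) 1 one_pos).and
      ((eventually_mul_log_pow_le ((3072 * (r + 1)) ^ r) r hδ).and (Filter.eventually_ge_atTop 3)))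
  refine ⟨p₀, fun p hpp₀ hp V _ _ hpV hV ι s a hs => ?_⟩
  obtain ⟨h1, h2, h3⟩ := hp₀ p hpp₀
  have hpos : (0 : ℝ) < p := by exact_mod_cast hp.pos
  have hlog1 : 1 ≤ Real.log p := by
    rw [Real.le_log_iff_exp_le hpos]
    have : (3 : ℝ) ≤ p := by exact_mod_cast h3
    linarith [Real.exp_one_lt_d9]
  set t := Nat.log 2 p + 1 with ht
  have hpt : p < 2 ^ t := Nat.lt_pow_succ_log_self one_lt_two p
  have htlog : (t : ℝ) ≤ 3 * Real.log p := by
    have h4 : (2 : ℝ) ^ Nat.log 2 p ≤ p := by exact_mod_cast Nat.pow_log_le_self 2 hp.ne_zero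
    have h5 := Real.log_le_log (by positivity) h4
    rw [Real.log_pow] at h5
    have h6 : (Nat.log 2 p : ℝ) * (1 / 2) ≤ Nat.log 2 p * Real.log 2 := by
      gcongr
      linarith [Real.log_two_gt_d9]
    rw [ht]
    push_cast
    linarith
  set A := t * (r + 1) with hA
  have hA0 : 0 < A := by positivity
  have hAlog : (A : ℝ) ≤ 3 * (r + 1) * Real.log p := by
    rw [hA]
    push_cast
    nlinarith [mul_le_mul_of_nonneg_right htlog (by positivity : (0 : ℝ) ≤ r + 1)]
  have hAp : 16 * A ≤ p := by
    have : (16 * A : ℝ) ≤ p := by linarith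
    exact_mod_cast this
  -- With this J there is room for 4JA growth steps, since 4JA ≤ p/4. By Bernoulli every 4J steps at
  -- least double the set, so it reaches 2^A ≥ p^r.
  set J := p / (16 * A) with hJ
  have hJ0 : 0 < J := Nat.div_pos hAp (by omega)
  have hJle : 16 * A * J ≤ p := Nat.mul_div_le p _
  have hJlt : p < 16 * A * (J + 1) := Nat.lt_mul_div_succ p (by omega)
  have hJr : (0 : ℝ) < J := by exact_mod_cast hJ0
  -- From p < 16A(J + 1) ≤ 32AJ one gets 32p ≤ KJ. The choice K = O(log p) makes K^r·p at most δp²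
  -- for large p.
  refine exists_zero_sum_card_eq_prime (J := J) (K := 1024 * A) (R := r) hp (by omega) hJ0
    (Nat.div_le_self _ _) ?_ ?_ r le_rfl hpV hV s a ?_
  · nlinarith
  · have h4 : 4 * J * A ≤ (p - 1) / 2 := by
      have : 4 * (4 * J * A) ≤ p := by linarith
      omega
    have h5 : (p : ℝ) ^ r ≤ (1 + 1 / (4 * J) : ℝ) ^ ((p - 1) / 2) := by
      calc (p : ℝ) ^ r ≤ ((2 : ℝ) ^ t) ^ (r + 1) := by
            have : p ^ r ≤ (2 ^ t) ^ (r + 1) :=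
              (Nat.pow_le_pow_left hpt.le r).trans
                (Nat.pow_le_pow_right (by positivity) (Nat.le_succ r))
            exact_mod_cast this
        _ = 2 ^ A := by rw [← pow_mul]
        _ ≤ ((1 + 1 / (4 * J) : ℝ) ^ (4 * J)) ^ A := by
            gcongr
            have h6 := one_add_mul_le_pow (a := (1 / (4 * J) : ℝ))
              (by linarith [show (0 : ℝ) ≤ 1 / (4 * J) by positivity]) (4 * J)
            have h7 : ((4 * J : ℕ) : ℝ) * (1 / (4 * J)) = 1 := by
              push_cast
              field_simp
            linarith
        _ = (1 + 1 / (4 * J) : ℝ) ^ (4 * J * A) := by rw [← pow_mul]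
        _ ≤ _ := pow_le_pow_right₀ (by linarith [show (0 : ℝ) ≤ 1 / (4 * J) by positivity]) h4
    have h6 : (0 : ℝ) < p ^ r := by positivity
    linarith
  · have h4 : ((1024 * A : ℕ) : ℝ) ^ r ≤ δ * p := by
      refine le_trans ?_ h2
      rw [← mul_pow]
      push_cast
      refine pow_le_pow_left₀ (by positivity) ?_ r
      linarith
    have h5 : ((1024 * A : ℕ) : ℝ) ^ r * p ≤ #s := by nlinarith
    exact_mod_cast h5

/-! ### Olson's bound from Chevalley–Warning -/

/-- Olson's bound for elementary `p`-groups: more than `r (p - 1)` elements of a group of order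
`p ^ r` and exponent `p` contain a nonempty zero-sum subfamily. -/
theorem exists_zero_sum_of_mul_lt_card_of_module {p r : ℕ} [hp : Fact p.Prime] {V : Type*}
    [AddCommGroup V] [Finite V] [Module (ZMod p) V] (hV : Nat.card V = p ^ r) {ι : Type*}
    (s : Finset ι) (a : ι → V) (hs : r * (p - 1) < #s) :
    ∃ T ⊆ s, T.Nonempty ∧ ∑ i ∈ T, a i = 0 := by
  classical
  have hp := hp.out
  have := Fintype.ofFinite V
  have : Module.Finite (ZMod p) V := Module.Finite.of_finite
  have hr : Module.finrank (ZMod p) V = r := by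
    have h := Module.card_eq_pow_finrank (K := ZMod p) (V := V)
    rw [← Nat.card_eq_fintype_card, hV, ZMod.card] at h
    exact (Nat.pow_right_injective hp.two_le h).symm
  let b := Module.finBasis (ZMod p) V
  -- Since x^(p-1) is the indicator of x ≠ 0, a common zero of the coordinate polynomials selects a
  -- subfamily of sum zero. The zero vector is a solution and p divides the number of solutions, so
  -- a nonzero one exists.
  let f : Fin (Module.finrank (ZMod p) V) → MvPolynomial s (ZMod p) := fun j =>
    ∑ i : s, MvPolynomial.C (b.repr (a i) j) * MvPolynomial.X i ^ (p - 1)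
  have hdeg : ∀ j, (f j).totalDegree ≤ p - 1 := by
    intro j
    refine MvPolynomial.totalDegree_finsetSum_le fun i _ => ?_
    refine (MvPolynomial.totalDegree_mul _ _).trans ?_
    rw [MvPolynomial.totalDegree_C, MvPolynomial.totalDegree_X_pow, zero_add]
  have hlt : ∑ j, (f j).totalDegree < Fintype.card s := by
    refine (sum_le_sum fun j _ => hdeg j).trans_lt ?_
    simpa [hr] using hs
  have hdvd : p ∣ Nat.card {x : s → ZMod p // ∀ j, MvPolynomial.eval x (f j) = 0} := by
    rw [Nat.card_eq_fintype_card]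
    convert char_dvd_card_solutions_of_fintype_sum_lt p hlt
  have hp1 : p - 1 ≠ 0 := by have := hp.two_le; omega
  have hf : ∀ x j, MvPolynomial.eval x (f j) = ∑ i : s, b.repr (a i) j * x i ^ (p - 1) := by
    intro x j
    simp [f]
  let x₀ : {x : s → ZMod p // ∀ j, MvPolynomial.eval x (f j) = 0} :=
    ⟨0, fun j => by rw [hf]; simp [hp1]⟩
  have : Nonempty {x : s → ZMod p // ∀ j, MvPolynomial.eval x (f j) = 0} := ⟨x₀⟩
  have hone := hp.one_lt.trans_le (Nat.le_of_dvd Nat.card_pos hdvd)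
  have := Finite.one_lt_card_iff_nontrivial.mp hone
  obtain ⟨⟨x, hx⟩, hne⟩ := exists_ne x₀
  have hx0 : x ≠ 0 := fun h => hne (Subtype.ext h)
  obtain ⟨i, hi⟩ := Function.ne_iff.mp hx0
  refine ⟨(univ.filter fun i => x i ≠ 0).map (Function.Embedding.subtype _), ?_, ?_, ?_⟩
  · intro j hj
    simp only [mem_map, Function.Embedding.subtype_apply] at hj
    obtain ⟨j, _, rfl⟩ := hj
    exact j.2
  · exact ⟨i, mem_map_of_mem _ (mem_filter.mpr ⟨mem_univ _, hi⟩)⟩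
  · rw [sum_map]
    refine b.ext_elem fun j => ?_
    rw [map_sum, map_zero, Finsupp.zero_apply, Finsupp.finsetSum_apply, sum_filter]
    refine Eq.trans ?_ ((hf x j).symm.trans (hx j))
    refine sum_congr rfl fun k _ => ?_
    split_ifs with h
    · rw [ZMod.pow_card_sub_one_eq_one h, mul_one]
      rfl
    · rw [not_not.mp h, zero_pow hp1, mul_zero]

theorem exists_zero_sum_of_mul_lt_card {p r : ℕ} (hp : p.Prime) {V : Type*} [AddCommGroup V]
    [Finite V] (hpV : ∀ v : V, p • v = 0) (hV : Nat.card V = p ^ r) {ι : Type*} (s : Finset ι)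
    (a : ι → V) (hs : r * (p - 1) < #s) : ∃ T ⊆ s, T.Nonempty ∧ ∑ i ∈ T, a i = 0 := by
  have : Fact p.Prime := ⟨hp⟩
  let _ : Module (ZMod p) V := AddCommGroup.zmodModule hpV
  exact exists_zero_sum_of_mul_lt_card_of_module hV s a hs

/-! ### Cross numbers of zero-sum free families -/

section ZeroSumFree

variable {G : Type*} [AddCommGroup G]

/-- The subfamily of `a` indexed by `s` has no nonempty subfamily of sum zero. -/
def IsZeroSumFree {ι : Type*} (s : Finset ι) (a : ι → G) : Prop :=
  ∀ T ⊆ s, T.Nonempty → ∑ i ∈ T, a i ≠ 0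

/-- A subsum through the merged element unfolds to a subsum of the original family containing all of
T. The index t ∈ T is reused for the merged element. -/
theorem IsZeroSumFree.merge {ι : Type*} [DecidableEq ι] {s : Finset ι} {a : ι → G}
    (h : IsZeroSumFree s a) {T : Finset ι} (hT : T ⊆ s) {t : ι} (ht : t ∈ T) :
    IsZeroSumFree (insert t (s \ T)) (Function.update a t (∑ i ∈ T, a i)) := by
  intro U hU hUne h0
  have hcongr : ∀ W : Finset ι, t ∉ W →
      ∑ i ∈ W, Function.update a t (∑ i ∈ T, a i) i = ∑ i ∈ W, a i := fun W hW =>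
    sum_congr rfl fun i hi => Function.update_of_ne (ne_of_mem_of_not_mem hi hW) _ _
  by_cases htU : t ∈ U
  · have hsub : U.erase t ⊆ s \ T := fun i hi =>
      (mem_insert.mp (hU (mem_of_mem_erase hi))).resolve_left (ne_of_mem_erase hi)
    have hdisj : Disjoint (U.erase t) T := disjoint_of_subset_left hsub sdiff_disjoint
    refine h (U.erase t ∪ T) (union_subset (hsub.trans sdiff_subset) hT)
      ⟨t, mem_union_right _ ht⟩ ?_
    rw [sum_union hdisj, ← h0, ← sum_erase_add _ _ htU, hcongr _ (notMem_erase _ _),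
      Function.update_self]
  · refine h U (fun i hi => ?_) hUne (by rw [← h0, hcongr U htU])
    exact (mem_sdiff.mp ((mem_insert.mp (hU hi)).resolve_left fun hit => htU (hit ▸ hi))).1

/-- The `p`-torsion subgroup. -/
abbrev torsion (G : Type*) [AddCommGroup G] (p : ℕ) : AddSubgroup G :=
  (nsmulAddMonoidHom p : G →+ G).ker

theorem mem_torsion {p : ℕ} {g : G} : g ∈ torsion G p ↔ p • g = 0 := Iff.rfl

theorem PrimePowerDecomposition.card_torsion_prime (D : PrimePowerDecomposition G) {p : ℕ}
    (hp : p.Prime) : Nat.card (torsion G p) = p ^ #{i | D.p i = p} := by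
  have h := D.card_torsion p 1 hp
  rw [pow_one] at h
  refine Eq.trans h ?_
  rw [card_filter]
  congr 1
  refine sum_congr rfl fun i _ => ?_
  split_ifs
  · exact min_eq_left (D.pos i)
  · rfl

theorem PrimePowerDecomposition.finite (D : PrimePowerDecomposition G) : Finite G := by
  have : ∀ i, NeZero (D.p i ^ D.e i) := fun i => ⟨pow_ne_zero _ (D.prime i).ne_zero⟩
  exact Finite.of_equiv _ D.equiv.symm.toEquiv

theorem IsZeroSumFree.card_filter_addOrderOf_eq_le (D : PrimePowerDecomposition G) [DecidableEq G]
    {ι : Type*} {s : Finset ι}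
    {a : ι → G} (h : IsZeroSumFree s a) {p : ℕ} (hp : p.Prime) :
    #{i ∈ s | addOrderOf (a i) = p} ≤ #{i | D.p i = p} * (p - 1) := by
  classical
  have := D.finite
  by_contra! hlt
  obtain ⟨T, hT, hTne, hT0⟩ := exists_zero_sum_of_mul_lt_card hp
    (V := torsion G p) (fun v => Subtype.ext v.2) (D.card_torsion_prime hp)
    {i ∈ s | addOrderOf (a i) = p}
    (fun i => if h : p • a i = 0 then ⟨a i, h⟩ else 0) hlt
  refine h T (hT.trans (filter_subset _ _)) hTne ?_
  rw [← map_zero (torsion G p).subtype, ← hT0, map_sum]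
  refine sum_congr rfl fun i hi => ?_
  rw [dif_pos (by rw [← (mem_filter.mp (hT hi)).2]; exact addOrderOf_nsmul_eq_zero _)]
  rfl

/-- If the `p`-torsion of `G` satisfies the zero-sum property of
`eventually_exists_zero_sum_card_eq_prime` for all primes `p`, then the cross number of a
zero-sum free family exceeds the number of cyclic summands of `G` by at most `δ` for each divisor
of the order of `G`. -/
theorem IsZeroSumFree.sum_inv_addOrderOf_le (D : PrimePowerDecomposition G) {δ : ℝ} (hδ : 0 < δ)
    {ι : Type*} [DecidableEq ι]
    (H : ∀ p, p.Prime → p ∣ Nat.card G → ∀ (s : Finset ι) (b : ι → torsion G p),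
      δ * (p : ℝ) ^ 2 ≤ #s → ∃ T ⊆ s, #T = p ∧ ∑ i ∈ T, b i = 0) :
    ∀ (s : Finset ι) (a : ι → G), IsZeroSumFree s a →
      ∑ i ∈ s, 1 / (addOrderOf (a i) : ℝ) ≤
        Fintype.card D.ι + #(Nat.card G).divisors * δ := by
  classical
  have := D.finite
  intro s
  induction hn : #s using Nat.strong_induction_on generalizing s with
  | _ n ih =>
  subst hn
  intro a hsa
  -- Prime orders are excluded because Olson's bound handles them. Merging shortens the family, so
  -- the induction is on its length.
  by_cases hbig : ∃ d : ℕ, d ≠ 1 ∧ ¬ d.Prime ∧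
      δ * (d.minFac : ℝ) ^ 2 ≤ #{i ∈ s | addOrderOf (a i) = d} ∧ d ∣ Nat.card G
  · obtain ⟨d, hd1, hdp, hd, hdG⟩ := hbig
    have hp := Nat.minFac_prime hd1
    obtain ⟨m, hm⟩ := Nat.minFac_dvd d
    have hd0 : 0 < d := Nat.pos_of_dvd_of_pos hdG Nat.card_pos
    set p := d.minFac
    have hm0 : 0 < m := Nat.pos_of_ne_zero (by rintro rfl; simp at hm; omega)
    have htors : ∀ i, addOrderOf (a i) = d → m • a i ∈ torsion G p := by
      intro i hi
      rw [mem_torsion, ← mul_nsmul', ← hm, ← hi]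
      exact addOrderOf_nsmul_eq_zero _
    obtain ⟨T, hT, hTc, hT0⟩ := H p hp ((Nat.minFac_dvd d).trans hdG)
      {i ∈ s | addOrderOf (a i) = d}
      (fun i => if h : addOrderOf (a i) = d then ⟨m • a i, htors i h⟩ else 0) hd
    have hTs : T ⊆ s := hT.trans (filter_subset _ _)
    have hTd : ∀ i ∈ T, addOrderOf (a i) = d := fun i hi => (mem_filter.mp (hT hi)).2
    obtain ⟨t, ht⟩ : T.Nonempty := card_pos.mp (hTc ▸ hp.pos)
    have hsum : m • ∑ i ∈ T, a i = 0 := by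
      rw [← map_zero (torsion G p).subtype, ← hT0, map_sum, smul_sum]
      refine sum_congr rfl fun i hi => ?_
      rw [dif_pos (hTd i hi)]
      rfl
    have htST : t ∉ s \ T := fun h => (mem_sdiff.mp h).2 ht
    have hcard := card_sdiff_add_card_eq_card hTs
    have hlt : #(insert t (s \ T)) < #s := by
      rw [card_insert_of_notMem htST]
      have := hp.two_le
      omega
    refine le_trans ?_ (ih _ hlt _ rfl _ (hsa.merge hTs ht))
    rw [sum_insert htST, Function.update_self, ← sum_sdiff hTs, add_comm]
    refine add_le_add ?_ (le_of_eq ?_)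
    · rw [sum_congr rfl fun i hi => by rw [hTd i hi], sum_const, hTc, nsmul_eq_mul]
      have hle : (addOrderOf (∑ i ∈ T, a i) : ℝ) ≤ m := by
        exact_mod_cast Nat.le_of_dvd hm0 (addOrderOf_dvd_of_nsmul_eq_zero hsum)
      have hpos : (0 : ℝ) < addOrderOf (∑ i ∈ T, a i) := by exact_mod_cast addOrderOf_pos _
      have hp0 : (p : ℝ) ≠ 0 := by exact_mod_cast hp.ne_zero
      have hm0' : (m : ℝ) ≠ 0 := by exact_mod_cast hm0.ne'
      -- The p merged elements had total weight p/d = 1/m, and the order of their sum is at most m.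
      calc (p : ℝ) * (1 / d) = 1 / m := by
            rw [hm]
            push_cast
            field_simp
        _ ≤ _ := one_div_le_one_div_of_le hpos hle
    · refine sum_congr rfl fun i hi => ?_
      rw [Function.update_of_ne (ne_of_mem_of_not_mem hi htST)]
  · push Not at hbig
    rw [← sum_fiberwise_of_maps_to (g := fun i => addOrderOf (a i)) (t := (Nat.card G).divisors)
      fun i _ => Nat.mem_divisors.mpr ⟨addOrderOf_dvd_natCard _, Nat.card_pos.ne'⟩]
    have hterm : ∀ d ∈ (Nat.card G).divisors,
        ∑ i ∈ s with addOrderOf (a i) = d, 1 / (addOrderOf (a i) : ℝ) ≤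
          (#{i | D.p i = d} : ℝ) + δ := by
      intro d hd
      have hd0 := Nat.pos_of_mem_divisors hd
      have hd0' : (0 : ℝ) < d := by exact_mod_cast hd0
      rw [sum_congr rfl fun i hi => by rw [(mem_filter.mp hi).2], sum_const, nsmul_eq_mul,
        mul_one_div, div_le_iff₀ hd0']
      by_cases hdp : d.Prime
      · have h1 := hsa.card_filter_addOrderOf_eq_le D hdp
        have h2 : #{i ∈ s | addOrderOf (a i) = d} ≤ #{i | D.p i = d} * d :=
          h1.trans (Nat.mul_le_mul_left _ (Nat.sub_le _ _))
        have h3 : (#{i ∈ s | addOrderOf (a i) = d} : ℝ) ≤ #{i | D.p i = d} * d := by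
          exact_mod_cast h2
        nlinarith
      · have hnn : (0 : ℝ) ≤ #{i | D.p i = d} * d := by positivity
        rw [add_mul]
        by_cases hd1 : d = 1
        · have : {i ∈ s | addOrderOf (a i) = d} = ∅ := by
            rw [filter_eq_empty_iff]
            intro i hi h
            rw [hd1, AddMonoid.addOrderOf_eq_one_iff] at h
            exact hsa {i} (singleton_subset_iff.mpr hi) (singleton_nonempty i) (by simpa using h)
          rw [this]
          have : (0 : ℝ) < δ * d := by positivity
          simp only [card_empty, Nat.cast_zero]
          linarith
        · have h1 : (#{i ∈ s | addOrderOf (a i) = d} : ℝ) < δ * (d.minFac : ℝ) ^ 2 := by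
            by_contra! h
            exact hbig d hd1 hdp h (Nat.dvd_of_mem_divisors hd)
          -- For composite d the square of the least prime is at most d, so fewer than δp² elements
          -- of order d weigh less than δ.
          have h2 : (d.minFac : ℝ) ^ 2 ≤ d := by exact_mod_cast Nat.minFac_sq_le_self hd0 hdp
          nlinarith
    refine (sum_le_sum hterm).trans ?_
    rw [sum_add_distrib, sum_const, nsmul_eq_mul]
    gcongr
    have : ∑ d ∈ (Nat.card G).divisors, #{i | D.p i = d} ≤ Fintype.card D.ι := by
      rw [sum_card_fiberwise_eq_card_filter]
      exact (card_filter_le _ _).trans_eq card_univ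
    exact_mod_cast this

end ZeroSumFree

/-! ### From UFIMs to zero-sum free families -/

section UniqueFactorization

variable {G : Type*} [AddCommGroup G] {ℓ : ℕ} {s : Fin ℓ → G}
  {P : Finpartition (univ : Finset (Fin ℓ))}

/-- Any minimal zero-sum submultiset extends to a factorization, and there is only one. -/
theorem IsUFIM.mem_parts (hs : IsUFIM s) (hP : IsIrreducibleFactorization s P)
    {J : Finset (Fin ℓ)} (hne : J.Nonempty) (hJ : IsMinimalZeroSum s J) : J ∈ P.parts := by
  obtain ⟨Q, hQ, hJQ⟩ := exists_factorization_mem s hs.2.1 J hne hJ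
  rwa [hs.2.2.unique hP hQ]

/-- In a unique factorization indexed multiset every zero-sum submultiset is a union of blocks. -/
theorem IsUFIM.part_subset (hs : IsUFIM s) (hP : IsIrreducibleFactorization s P)
    {J : Finset (Fin ℓ)} (hJ : ∑ i ∈ J, s i = 0) {B : Finset (Fin ℓ)} (hB : B ∈ P.parts)
    {i : Fin ℓ} (hiB : i ∈ B) (hiJ : i ∈ J) : B ⊆ J := by
  obtain ⟨Q, hQ⟩ := exists_factorization s J hJ
  obtain ⟨K, hK, hiK⟩ := Q.exists_mem hiJ
  have hKP := hs.mem_parts hP (Q.nonempty_of_mem_parts hK) (hQ K hK)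
  rw [P.eq_of_mem_parts hB hKP hiB hiK]
  exact Q.le hK

theorem IsUFIM.exists_ne_mem_part (hs : IsUFIM s) (hP : IsIrreducibleFactorization s P)
    {B : Finset (Fin ℓ)} (hB : B ∈ P.parts) (i : Fin ℓ) : ∃ j ∈ B, j ≠ i := by
  by_contra! h
  obtain ⟨k, hk⟩ := P.nonempty_of_mem_parts hB
  have hBi : B = {k} :=
    eq_singleton_iff_unique_mem.mpr ⟨hk, fun j hj => (h j hj).trans (h k hk).symm⟩
  have h0 := (hP B hB).1
  rw [hBi, sum_singleton] at h0
  exact hs.1 k h0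

/-- Sums of representatives of different sets of blocks are different. -/
theorem IsUFIM.two_pow_card_parts_le [Finite G] (hs : IsUFIM s)
    (hP : IsIrreducibleFactorization s P) {rep : Finset (Fin ℓ) → Fin ℓ}
    (hrep : ∀ B ∈ P.parts, rep B ∈ B) : 2 ^ #P.parts ≤ Nat.card G := by
  classical
  have := Fintype.ofFinite G
  rw [← card_powerset, Nat.card_eq_fintype_card, ← card_univ]
  refine card_le_card_of_injOn (fun X => ∑ B ∈ X, s (rep B)) (fun _ _ => mem_univ _) ?_
  intro X hX X' hX' hXX'
  have hX := mem_powerset.mp hX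
  have hX' := mem_powerset.mp hX'
  simp only at hXX'
  have heq : ∀ {B B' i}, B ∈ P.parts → B' ∈ P.parts → i ∈ B → i ∈ B' → B = B' :=
    fun hB hB' h h' => P.eq_of_mem_parts hB hB' h h'
  -- If X and X' have equal sums of representatives, this set is zero-sum: a block without its
  -- representative sums to minus that representative. It then cuts through every block in the
  -- symmetric difference, as blocks have at least two elements, contradicting `part_subset`.
  set Z := (X \ X').image rep ∪ (X' \ X).biUnion fun B => B.erase (rep B) with hZdef
  have hZ : ∀ {j B}, B ∈ P.parts → j ∈ B → j ∈ Z →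
      (B ∈ X \ X' ∧ j = rep B) ∨ (B ∈ X' \ X ∧ j ≠ rep B) := by
    intro j B hB hjB hj
    rcases mem_union.mp hj with h | h
    · obtain ⟨B', hB', rfl⟩ := mem_image.mp h
      have hB'P := hX (mem_sdiff.mp hB').1
      obtain rfl := heq hB hB'P hjB (hrep _ hB'P)
      exact Or.inl ⟨hB', rfl⟩
    · obtain ⟨B', hB', hjB'⟩ := mem_biUnion.mp h
      have hB'P := hX' (mem_sdiff.mp hB').1
      obtain rfl := heq hB hB'P hjB (mem_of_mem_erase hjB')
      exact Or.inr ⟨hB', ne_of_mem_erase hjB'⟩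
  have hdisj : Disjoint ((X \ X').image rep) ((X' \ X).biUnion fun B => B.erase (rep B)) := by
    rw [disjoint_left]
    intro j hj hj'
    obtain ⟨B, hB, rfl⟩ := mem_image.mp hj
    obtain ⟨B', hB', hjB'⟩ := mem_biUnion.mp hj'
    have hBP := hX (mem_sdiff.mp hB).1
    have hB'P := hX' (mem_sdiff.mp hB').1
    obtain rfl := heq hBP hB'P (hrep _ hBP) (mem_of_mem_erase hjB')
    exact (mem_sdiff.mp hB).2 (mem_sdiff.mp hB').1
  have hZ0 : ∑ i ∈ Z, s i = 0 := by
    rw [hZdef, sum_union hdisj, sum_image, sum_biUnion]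
    · have h : ∀ B ∈ X' \ X, ∑ i ∈ B.erase (rep B), s i = - s (rep B) := by
        intro B hB
        have hBP := hX' (mem_sdiff.mp hB).1
        have := add_sum_erase B s (hrep B hBP)
        rw [(hP B hBP).1] at this
        exact eq_neg_of_add_eq_zero_right this
      rw [sum_congr rfl h, sum_neg_distrib, ← sub_eq_add_neg, sum_sdiff_sub_sum_sdiff, hXX',
        sub_self]
    · intro B hB B' hB' hne
      refine disjoint_of_subset_left (erase_subset _ _) (disjoint_of_subset_right
        (erase_subset _ _) (P.disjoint ?_ ?_ hne))
      · exact hX' (mem_sdiff.mp hB).1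
      · exact hX' (mem_sdiff.mp hB').1
    · intro B hB B' hB' h
      have hBP := hX (mem_sdiff.mp hB).1
      have hB'P := hX (mem_sdiff.mp hB').1
      exact heq hBP hB'P (hrep B hBP) (h ▸ hrep B' hB'P)
  refine Subset.antisymm (fun B hB => ?_) fun B hB => ?_
  · by_contra hB'
    have hBX : B ∈ X \ X' := mem_sdiff.mpr ⟨hB, hB'⟩
    have hBP := hX hB
    obtain ⟨j, hjB, hj⟩ := hs.exists_ne_mem_part hP hBP (rep B)
    have hjZ := hs.part_subset hP hZ0 hBP (hrep B hBP)
      (mem_union_left _ (mem_image_of_mem _ hBX)) hjB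
    rcases hZ hBP hjB hjZ with h | h
    · exact hj h.2
    · exact hB' (mem_sdiff.mp h.1).1
  · by_contra hB'
    have hBX : B ∈ X' \ X := mem_sdiff.mpr ⟨hB, hB'⟩
    have hBP := hX' hB
    obtain ⟨j, hjB, hj⟩ := hs.exists_ne_mem_part hP hBP (rep B)
    have hjZ := hs.part_subset hP hZ0 hBP hjB (mem_union_right _
      (mem_biUnion.mpr ⟨B, hBX, mem_erase.mpr ⟨hj, hjB⟩⟩)) (hrep B hBP)
    rcases hZ hBP (hrep B hBP) hjZ with h | h
    · exact hB' (mem_sdiff.mp h.1).1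
    · exact h.2 rfl

/-- Deleting one element from each block turns a unique factorization indexed multiset into a
zero-sum free one. -/
theorem IsUFIM.isZeroSumFree_sdiff (hs : IsUFIM s) (hP : IsIrreducibleFactorization s P)
    {rep : Finset (Fin ℓ) → Fin ℓ} (hrep : ∀ B ∈ P.parts, rep B ∈ B) :
    IsZeroSumFree (univ \ P.parts.image rep) s := by
  rintro T hT ⟨i, hi⟩ h0
  obtain ⟨B, hB, hiB⟩ := P.exists_mem (mem_univ i)
  have := hT (hs.part_subset hP h0 hB hiB hi (hrep B hB))
  exact (mem_sdiff.mp this).2 (mem_image_of_mem _ hB)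

theorem minFac_card_le_addOrderOf [Finite G] {g : G} (hg : g ≠ 0) :
    (Nat.card G).minFac ≤ addOrderOf g := by
  have h1 : addOrderOf g ≠ 1 := by rwa [ne_eq, AddMonoid.addOrderOf_eq_one_iff]
  exact (Nat.minFac_le_of_dvd (Nat.minFac_prime h1).two_le
    ((Nat.minFac_dvd _).trans (addOrderOf_dvd_natCard g))).trans
    (Nat.minFac_le (addOrderOf_pos g))

/-- A unique factorization indexed multiset has almost the cross number of a zero-sum free
family. -/
theorem IsUFIM.crossNumber_le [Finite G] (hs : IsUFIM s) {K : ℝ}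
    (hK : ∀ T : Finset (Fin ℓ), IsZeroSumFree T s → ∑ i ∈ T, 1 / (addOrderOf (s i) : ℝ) ≤ K) :
    crossNumber s ≤ K + Nat.log 2 (Nat.card G) / (smallestPrime (Nat.card G) : ℝ) := by
  classical
  obtain ⟨P, hP, -⟩ := hs.2.2
  -- The empty multiset is separate because the choice of representatives needs a default index.
  rcases Nat.eq_zero_or_pos ℓ with rfl | hℓ
  · have h := hK ∅ fun T hT hne => absurd (subset_empty.mp hT) hne.ne_empty
    rw [sum_empty] at h
    have : (0 : ℝ) ≤ Nat.log 2 (Nat.card G) / (smallestPrime (Nat.card G) : ℝ) := by positivity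
    simp only [crossNumber, univ_eq_empty, sum_empty]
    linarith
  have : Nonempty (Fin ℓ) := ⟨⟨0, hℓ⟩⟩
  have hex : ∀ B, ∃ i, B ∈ P.parts → i ∈ B := fun B => by
    by_cases hB : B ∈ P.parts
    · obtain ⟨i, hi⟩ := P.nonempty_of_mem_parts hB
      exact ⟨i, fun _ => hi⟩
    · exact ⟨Classical.arbitrary _, fun h => absurd h hB⟩
  choose rep hrep using hex
  have hcard : #(P.parts.image rep) ≤ Nat.log 2 (Nat.card G) :=
    card_image_le.trans (Nat.le_log_of_pow_le one_lt_two (hs.two_pow_card_parts_le hP hrep))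
  rw [crossNumber, ← sum_sdiff (subset_univ (P.parts.image rep))]
  refine add_le_add (hK _ (hs.isZeroSumFree_sdiff hP hrep)) ?_
  have hpos : (0 : ℝ) < smallestPrime (Nat.card G) := by
    exact_mod_cast Nat.minFac_pos _
  have hterm : ∀ i ∈ P.parts.image rep,
      1 / (addOrderOf (s i) : ℝ) ≤ 1 / (smallestPrime (Nat.card G) : ℝ) := fun i _ =>
    one_div_le_one_div_of_le hpos (by exact_mod_cast minFac_card_le_addOrderOf (hs.1 i))
  refine (sum_le_sum hterm).trans ?_
  rw [sum_const, nsmul_eq_mul, mul_one_div]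
  gcongr

end UniqueFactorization

/-! ### The lower bound for K₁ -/

section LowerBound

variable {G : Type*} [AddCommGroup G]

/-- The union of the constant families of length `p i` at independent elements `g i` of order
`p i` is a unique factorization indexed multiset. -/
theorem isUFIM_of_independent {I : Type*} [Fintype I] [DecidableEq I] {p : I → ℕ} {g : I → G}
    (hg : ∀ i, p i • g i = 0)
    (hind : ∀ c : I → ℕ, ∑ i, c i • g i = 0 → ∀ i, p i ∣ c i) (hg0 : ∀ i, g i ≠ 0)
    {ℓ : ℕ} (τ : Fin ℓ → I) (hτ : ∀ i, #{k | τ k = i} = p i) : IsUFIM fun k => g (τ k) := by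
  have hsum : ∀ J : Finset (Fin ℓ), ∑ k ∈ J, g (τ k) = ∑ i, #{k ∈ J | τ k = i} • g i := by
    intro J
    rw [← sum_fiberwise J τ]
    refine sum_congr rfl fun i _ => ?_
    rw [sum_congr rfl fun k hk => by rw [(mem_filter.mp hk).2], sum_const]
  -- By independence the multiplicity of g i in a zero-sum J is a multiple of p i, hence zero or
  -- everything available.
  have hblock : ∀ J : Finset (Fin ℓ), ∑ k ∈ J, g (τ k) = 0 → ∀ k ∈ J,
      (univ.filter fun k' => τ k' = τ k) ⊆ J := by
    intro J hJ k hk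
    rw [hsum] at hJ
    have hdvd := hind _ hJ (τ k)
    have hpos : 0 < #{k' ∈ J | τ k' = τ k} := card_pos.mpr ⟨k, mem_filter.mpr ⟨hk, rfl⟩⟩
    have hle := Nat.le_of_dvd hpos hdvd
    rw [← hτ] at hle
    rw [← eq_of_subset_of_card_le (filter_subset_filter _ (subset_univ J)) hle]
    exact filter_subset _ _
  have hzero : ∀ i, ∑ k with τ k = i, g (τ k) = 0 := by
    intro i
    rw [sum_congr rfl fun k hk => by rw [(mem_filter.mp hk).2], sum_const, hτ, hg]
  have huniv : ∑ k, g (τ k) = 0 := by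
    rw [hsum]
    exact sum_eq_zero fun i _ => by rw [hτ, hg]
  have hparts : ∀ Q : Finpartition (univ : Finset (Fin ℓ)),
      IsIrreducibleFactorization (fun k => g (τ k)) Q → ∀ J ∈ Q.parts, ∀ k ∈ J,
        J = univ.filter fun k' => τ k' = τ k := by
    intro Q hQ J hJ k hk
    by_contra hne
    refine (hQ J hJ).2 (univ.filter fun k' => τ k' = τ k) ⟨k, mem_filter.mpr ⟨mem_univ _, rfl⟩⟩ ?_ (hzero (τ k))
    exact ssubset_of_subset_of_ne (hblock J (hQ J hJ).1 k hk) (Ne.symm hne)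
  have hle : ∀ Q Q' : Finpartition (univ : Finset (Fin ℓ)),
      IsIrreducibleFactorization (fun k => g (τ k)) Q →
      IsIrreducibleFactorization (fun k => g (τ k)) Q' → Q.parts ⊆ Q'.parts := by
    intro Q Q' hQ hQ' J hJ
    obtain ⟨k, hk⟩ := Q.nonempty_of_mem_parts hJ
    obtain ⟨J', hJ', hk'⟩ := Q'.exists_mem (mem_univ k)
    rwa [hparts Q hQ J hJ k hk, ← hparts Q' hQ' J' hJ' k hk']
  obtain ⟨Q, hQ⟩ := exists_factorization (fun k => g (τ k)) univ huniv
  exact ⟨fun k => hg0 _, huniv, Q, hQ, fun Q' hQ' =>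
    Finpartition.ext (Subset.antisymm (hle _ _ hQ' hQ) (hle _ _ hQ hQ'))⟩

theorem PrimePowerDecomposition.card_le_K1 (D : PrimePowerDecomposition G) :
    (Fintype.card D.ι : ℝ) ≤ K1 G := by
  classical
  have := D.finite
  -- An element of order p i in the i-th summand; its p i copies contribute exactly 1 to the cross
  -- number.
  let z : (i : D.ι) → ZMod (D.p i ^ D.e i) := fun i => ((D.p i ^ (D.e i - 1) : ℕ) : ZMod _)
  let g : D.ι → G := fun i => D.equiv.symm (Pi.single i (z i))
  have hpe : ∀ i, D.p i ^ D.e i = D.p i ^ (D.e i - 1) * D.p i := fun i => by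
    rw [← pow_succ, Nat.sub_add_cancel (D.pos i)]
  have hz : ∀ i (c : ℕ), c • z i = 0 ↔ D.p i ∣ c := by
    intro i c
    rw [nsmul_eq_mul, ← Nat.cast_mul, ZMod.natCast_eq_zero_iff, hpe, mul_comm c]
    exact Nat.mul_dvd_mul_iff_left (pow_pos (D.prime i).pos _)
  have hg : ∀ i, D.p i • g i = 0 := by
    intro i
    rw [← map_nsmul, ← Pi.single_smul, (hz i _).mpr dvd_rfl, Pi.single_zero, map_zero]
  have hind : ∀ c : D.ι → ℕ, ∑ i, c i • g i = 0 → ∀ i, D.p i ∣ c i := by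
    intro c hc i
    have h1 := congrFun (congrArg D.equiv hc) i
    rw [map_sum, map_zero, Finset.sum_apply, sum_eq_single i] at h1
    · rw [← hz]
      simpa [g] using h1
    · intro j _ hj
      simp [g, Pi.single_eq_of_ne hj.symm]
    · simp
  have hgord : ∀ i, addOrderOf (g i) = D.p i := by
    intro i
    refine Nat.dvd_antisymm (addOrderOf_dvd_of_nsmul_eq_zero (hg i)) ?_
    have h := hind (Pi.single i (addOrderOf (g i))) ?_ i
    · rwa [Pi.single_eq_same] at h
    · rw [sum_eq_single i]
      · rw [Pi.single_eq_same, addOrderOf_nsmul_eq_zero]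
      · intro j _ hj
        rw [Pi.single_eq_of_ne hj, zero_nsmul]
      · simp
  have hg0 : ∀ i, g i ≠ 0 := by
    intro i h
    have := hgord i
    rw [h, addOrderOf_zero] at this
    exact (D.prime i).one_lt.ne this
  let φ := Fintype.equivFin (Σ i : D.ι, Fin (D.p i))
  have hτ : ∀ i, #{k | (φ.symm k).1 = i} = D.p i := by
    intro i
    rw [← Fintype.card_subtype, ← Fintype.card_fin (D.p i)]
    exact Fintype.card_congr ((φ.symm.subtypeEquiv fun _ => Iff.rfl).trans
      (Equiv.sigmaSubtype i))
  refine (isGreatest_K1 G).2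
    ⟨_, _, isUFIM_of_independent hg hind hg0 (fun k => (φ.symm k).1) hτ, ?_⟩
  have hcard : (Fintype.card D.ι : ℝ) = ∑ _i : D.ι, 1 := by simp
  rw [crossNumber, ← sum_fiberwise univ (fun k => (φ.symm k).1), hcard]
  refine sum_congr rfl fun i _ => ?_
  rw [sum_congr rfl fun k hk => by rw [(mem_filter.mp hk).2, hgord], sum_const, hτ, nsmul_eq_mul]
  have : (D.p i : ℝ) ≠ 0 := by exact_mod_cast (D.prime i).ne_zero
  exact mul_one_div_cancel this

end LowerBound

/-! ### Size estimates and the limit -/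

section Asymptotics

open Pointwise in
theorem card_divisors_prod_le {ι : Type*} (s : Finset ι) (f : ι → ℕ) :
    #(∏ i ∈ s, f i).divisors ≤ ∏ i ∈ s, #(f i).divisors := by
  classical
  induction s using Finset.induction_on with
  | empty => simp
  | insert i s hi ih =>
    rw [prod_insert hi, prod_insert hi, Nat.divisors_mul]
    exact card_mul_le.trans (Nat.mul_le_mul_left _ ih)

variable {G : Type*} [AddCommGroup G]

namespace PrimePowerDecomposition

variable (D : PrimePowerDecomposition G)

theorem card_eq_prod : Nat.card G = ∏ i, D.p i ^ D.e i := by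
  rw [Nat.card_congr D.equiv.toEquiv, Nat.card_pi]
  exact prod_congr rfl fun i _ => Nat.card_zmod _

theorem card_divisors_le : #(Nat.card G).divisors ≤ 2 ^ ∑ i, D.e i := by
  rw [D.card_eq_prod, ← prod_pow_eq_pow_sum]
  refine (card_divisors_prod_le _ _).trans (prod_le_prod' fun i _ => ?_)
  rw [Nat.divisors_prime_pow (D.prime i), card_map, card_range]
  exact Nat.lt_two_pow_self

theorem card_le_sum_e : Fintype.card D.ι ≤ ∑ i, D.e i := by
  rw [← card_univ, card_eq_sum_ones]
  exact sum_le_sum fun i _ => D.pos i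

theorem p_dvd_card (i : D.ι) : D.p i ∣ Nat.card G := by
  rw [D.card_eq_prod]
  exact (dvd_pow_self _ (by have := D.pos i; omega)).trans
    (dvd_prod_of_mem (fun i => D.p i ^ D.e i) (mem_univ i))

theorem smallestPrime_le (i : D.ι) : smallestPrime (Nat.card G) ≤ D.p i :=
  Nat.minFac_le_of_dvd (D.prime i).two_le (D.p_dvd_card i)

theorem le_largestPrime (i : D.ι) : D.p i ≤ largestPrime (Nat.card G) := by
  have := D.finite
  exact le_sup (f := id)
    (Nat.mem_primeFactors.mpr ⟨D.prime i, D.p_dvd_card i, Nat.card_pos.ne'⟩)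

theorem card_le_K1star : (Fintype.card D.ι : ℝ) ≤ D.K1star := by
  have hcard : (Fintype.card D.ι : ℝ) = ∑ _i : D.ι, 1 := by simp
  rw [hcard, K1star]
  refine sum_le_sum fun i _ => ?_
  have hp : (1 : ℝ) < D.p i := by exact_mod_cast (D.prime i).one_lt
  obtain ⟨m, hm⟩ : ∃ m, D.e i = m + 1 := ⟨D.e i - 1, by have := D.pos i; omega⟩
  have hpm : (1 : ℝ) ≤ (D.p i : ℝ) ^ m := one_le_pow₀ hp.le
  rw [hm, Nat.add_sub_cancel, pow_succ, one_le_div (by nlinarith)]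
  linarith

theorem K1star_le {k : ℕ} (hk : 1 < k) (hkp : ∀ i, k ≤ D.p i) :
    D.K1star ≤ Fintype.card D.ι + Fintype.card D.ι / (k - 1 : ℝ) := by
  have hcard : Fintype.card D.ι + Fintype.card D.ι / (k - 1 : ℝ) =
      ∑ _i : D.ι, (1 + 1 / (k - 1 : ℝ)) := by
    simp
    ring
  rw [hcard, K1star]
  refine sum_le_sum fun i _ => ?_
  have hk1 : (1 : ℝ) < k := by exact_mod_cast hk
  have hp : (k : ℝ) ≤ D.p i := by exact_mod_cast hkp i
  obtain ⟨m, hm⟩ : ∃ m, D.e i = m + 1 := ⟨D.e i - 1, by have := D.pos i; omega⟩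
  have hpm : (1 : ℝ) ≤ (D.p i : ℝ) ^ m := one_le_pow₀ (hk1.le.trans hp)
  have h1 : (1 : ℝ) ≤ 1 / (k - 1 : ℝ) * (D.p i - 1) := by
    rw [one_div_mul_eq_div, one_le_div (by linarith)]
    linarith
  rw [hm, Nat.add_sub_cancel, pow_succ, div_le_iff₀ (by nlinarith)]
  nlinarith

/-- |G| is a product of at most N primes, counted with multiplicity, each at most c times the
smallest one. -/
theorem card_le_pow {c : ℝ} (hG : InOmega c G) {N : ℕ} (hN : ∑ i, D.e i ≤ N)
    (hc : 1 ≤ c * smallestPrime (Nat.card G)) :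
    (Nat.card G : ℝ) ≤ (c * smallestPrime (Nat.card G)) ^ N := by
  have hcard : (Nat.card G : ℝ) = ∏ i, (D.p i : ℝ) ^ D.e i := by exact_mod_cast D.card_eq_prod
  rw [hcard]
  refine le_trans ?_ (pow_le_pow_right₀ hc hN)
  rw [← prod_pow_eq_pow_sum]
  refine prod_le_prod (fun i _ => by positivity) fun i _ => ?_
  refine pow_le_pow_left₀ (by positivity) ?_ _
  exact (Nat.cast_le.mpr (D.le_largestPrime i)).trans hG

end PrimePowerDecomposition

universe u

theorem eventually_abs_K1_sub_K1star_lt {c : ℝ} (hc : 1 ≤ c) (N : ℕ) {ε : ℝ} (hε : 0 < ε) :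
    ∃ M : ℕ, ∀ (G : Type u) [AddCommGroup G] [Finite G], InOmega c G → InS N G →
      M ≤ smallestPrime (Nat.card G) → |K1 G - K1star G| < ε := by
  -- |G| has at most 2^N divisors, each costing δ, so the total loss over all orders is at most ε/4.
  set δ : ℝ := ε / 4 / 2 ^ N with hδdef
  have hδ : 0 < δ := by positivity
  obtain ⟨p₀, hp₀⟩ := eventually_exists_zero_sum_card_eq_prime.{u, 0} N hδ
  have hlin : ∀ᶠ k : ℕ in Filter.atTop, (N : ℝ) ≤ ε / 4 * (k - 1) := by
    filter_upwards [Filter.eventually_ge_atTop ⌈N / (ε / 4) + 1⌉₊] with k hk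
    have := Nat.ceil_le.mp hk
    rw [← div_le_iff₀' (by positivity)]
    linarith
  obtain ⟨M, hM⟩ := Filter.eventually_atTop.mp
    ((eventually_mul_log_pow_le (4 * N) 1 (by positivity : 0 < ε / 4)).and
      (hlin.and ((Filter.eventually_ge_atTop ⌈c⌉₊).and
        ((Filter.eventually_ge_atTop p₀).and (Filter.eventually_ge_atTop 2)))))
  refine ⟨M, fun G _ _ hΩ ⟨D, hD⟩ hMG => ?_⟩
  set P := smallestPrime (Nat.card G) with hP
  obtain ⟨h1, h2, h3, h4, h5⟩ := hM P hMG
  have h3 : c ≤ P := Nat.ceil_le.mp h3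
  have hPr : (2 : ℝ) ≤ P := by exact_mod_cast h5
  have hιN : Fintype.card D.ι ≤ N := D.card_le_sum_e.trans hD
  have hιN' : (Fintype.card D.ι : ℝ) ≤ N := by exact_mod_cast hιN
  rw [K1star_eq D]
  have hlow := D.card_le_K1
  have hslow := D.card_le_K1star
  have hsup := D.K1star_le (k := P) (by omega) D.smallestPrime_le
  have hsup' : (Fintype.card D.ι : ℝ) / (P - 1 : ℝ) ≤ ε / 4 := by
    rw [div_le_iff₀ (by linarith)]
    exact hιN'.trans h2
  have hlog : (Nat.log 2 (Nat.card G) : ℝ) / P ≤ ε / 4 := by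
    rw [div_le_iff₀ (by linarith)]
    refine le_trans ?_ h1
    -- Once c ≤ P one has cP ≤ P². With log 2 ≥ 1/2 this gives log₂|G| ≤ 4N log P, whence the
    -- constant in the choice of M.
    have hcard : (Nat.card G : ℝ) ≤ ((P : ℝ) ^ 2) ^ N := by
      refine (D.card_le_pow hΩ hD (by nlinarith)).trans ?_
      refine pow_le_pow_left₀ (by positivity) ?_ _
      rw [sq]
      gcongr
    have hG0 : (0 : ℝ) < Nat.card G := by exact_mod_cast Nat.card_pos
    have hl := Real.log_le_log hG0 hcard
    rw [Real.log_pow, Real.log_pow] at hl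
    have h6 : (2 : ℝ) ^ Nat.log 2 (Nat.card G) ≤ Nat.card G := by
      exact_mod_cast Nat.pow_log_le_self 2 Nat.card_pos.ne'
    have h7 := Real.log_le_log (by positivity) h6
    rw [Real.log_pow] at h7
    have h8 : (Nat.log 2 (Nat.card G) : ℝ) * (1 / 2) ≤ Nat.log 2 (Nat.card G) * Real.log 2 := by
      gcongr
      linarith [Real.log_two_gt_d9]
    push_cast at hl
    linarith
  have hdiv : #(Nat.card G).divisors * δ ≤ ε / 4 := by
    have : (#(Nat.card G).divisors : ℝ) ≤ 2 ^ N := by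
      exact_mod_cast D.card_divisors_le.trans (Nat.pow_le_pow_right two_pos hD)
    calc #(Nat.card G).divisors * δ ≤ 2 ^ N * δ := by gcongr
      _ = ε / 4 := by
        rw [hδdef]
        field_simp
  have hup : K1 G ≤ Fintype.card D.ι + ε / 4 + ε / 4 := by
    obtain ⟨ℓ, s, hs, hK⟩ := (isGreatest_K1 G).1
    have hzsf : ∀ T : Finset (Fin ℓ), IsZeroSumFree T s →
        ∑ i ∈ T, 1 / (addOrderOf (s i) : ℝ) ≤
          Fintype.card D.ι + #(Nat.card G).divisors * δ := by
      refine fun T hT => IsZeroSumFree.sum_inv_addOrderOf_le D hδ ?_ T s hT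
      intro p hp hpG T b hT
      refine hp₀ p (h4.trans (Nat.minFac_le_of_dvd hp.two_le hpG)) hp (torsion G p)
        (fun v => Subtype.ext v.2) ?_ T b hT
      rw [D.card_torsion_prime hp]
      exact Nat.pow_le_pow_right hp.pos ((card_filter_le _ _).trans hιN)
    have := hs.crossNumber_le hzsf
    rw [hK] at this
    linarith
  rw [abs_lt]
  constructor <;> linarith

end Asymptotics

end CrossNumber

theorem corollary8p6 (c : ℝ) (hc : 1 ≤ c) (N r : ℕ) (l : Fin r → ℕ) :
    ∀ ε : ℝ, 0 < ε → ∃ M : ℕ, ∀ (G : Type*) [AddCommGroup G] [Finite G],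
      CrossNumber.InOmega c G → CrossNumber.InS N G → CrossNumber.InE l G →
      M ≤ CrossNumber.smallestPrime (Nat.card G) →
      |CrossNumber.K1 G - CrossNumber.K1star G| < ε := by
  intro ε hε
  obtain ⟨M, hM⟩ := CrossNumber.eventually_abs_K1_sub_K1star_lt hc N hε
  exact ⟨M, fun G _ _ hΩ hS _ hMG => hM G hΩ hS hMG⟩
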